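/- **Setting.** Let $d\ge 1$, let $\Omega\subset\mathbb R^d$ be open and bounded, let $T>0$ and $2\le p<\infty$. A space-time gradient discretisation $\mathcal D=(X_{\mathcal D,0},\Pi_{\mathcal D},\nabla_{\mathcal D},\mathcal I_{\mathcal D},(t^{(n)})_{n=0,\dots,N})$ consists of: the space $X_{\mathcal D,0}=\mathbb R^I$ with $I$ a finite set; a partition $\Omega=\bigcup_{i\in I}\Omega_i$ into disjoint (Lebesgue) measurable sets, with $\Pi_{\mathcal D}u=u_i$ on $\Omega_i$ for $u=(u_i)_{i\in I}$; a linear map $\nabla_{\mathcal D}:X_{\mathcal D,0}\to L^p(\Omega)^d$ such that $\|\nabla_{\mathcal D}\cdot\|_{L^p(\Omega)^d}$ is a norm; a linear map $\mathcal I_{\mathcal D}:L^2(\Omega)\to X_{\mathcal D,0}$; and times $0=t^{(0)}<t^{(1)}<\dots<t^{(N)}=T$. Let $\delta t_{\mathcal D}=\max_n (t^{(n+1)}-t^{(n)})$ and, for $w\in X_{\mathcal D,0}$, $$|w|_{\star,\mathcal D}=\sup\Big\{\int_\Omega \Pi_{\mathcal D}w\,\Pi_{\mathcal D}z\,dx:\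 z\in X_{\mathcal D,0},\ \|\nabla_{\mathcal D}z\|_{L^p(\Omega)^d}=1\Big\}$$ (with value $0$ if $X_{\mathcal D,0}=\{0\}$). For a family $v=(v^{(n)})_{n=0,\dots,N}\subset X_{\mathcal D,0}$ set $\Pi_{\mathcal D}v(\cdot,0)=\Pi_{\mathcal D}v^{(0)}$ and, for $t\in(t^{(n)},t^{(n+1)}]$, $\Pi_{\mathcal D}v(\cdot,t)=\Pi_{\mathcal D}v^{(n+1)}$, $\nabla_{\mathcal D}v(\cdot,t)=\nabla_{\mathcal D}v^{(n+1)}$, $\delta_{\mathcal D}v(t)=\dfrac{v^{(n+1)}-v^{(n)}}{t^{(n+1)}-t^{(n)}}\in X_{\mathcal D,0}$. A sequence $(\mathcal D_m)_{m\in\mathbb N}$ is *consistent* if, as $m\to\infty$, (i) for every $\varphi\in L^2(\Omega)\cap W^{1,p}_0(\Omega)$, $$\min_{w\in X_{\mathcal D_m,0}}\big(\|\Pi_{\mathcal D_m}w-\varphi\|_{L^{\max(p,2)}(\Omega)}+\|\nabla_{\mathcal D_m}w-\nabla\varphi\|_{L^p(\Omega)^d}\big)\to 0;$$ (ii) $\Pi_{\mathcal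 D_m}\mathcal I_{\mathcal D_m}\varphi\to\varphi$ in $L^2(\Omega)$ for every $\varphi\in L^2(\Omega)$; (iii) $\delta t_{\mathcal D_m}\to0$. It is *compact* if $\lim_{\xi\to0}\sup_{m}T_{\mathcal D_m}(\xi)=0$, where $$T_{\mathcal D}(\xi)=\max_{v\in X_{\mathcal D,0}\setminus\{0\}}\frac{\|\Pi_{\mathcal D}v(\cdot+\xi)-\Pi_{\mathcal D}v\|_{L^p(\mathbb R^d)}}{\|\nabla_{\mathcal D}v\|_{L^p(\Omega)^d}}$$ and $\Pi_{\mathcal D}v$ is extended by $0$ outside $\Omega$. **Theorem (Discrete compensated compactness).** Let $(\mathcal D_m)_{m\in\mathbb N}$ be a consistent and compact sequence of space-time gradient discretisations. For each $m$ let $\beta_m=(\beta_m^{(n)})_{n=0,\dots,N_m}$ and $\zeta_m=(\zeta_m^{(n)})_{n=0,\dots,N_m}$ be families in $X_{\mathcal D_m,0}$ such that - the sequences $\big(\int_0^T|\delta_{\mathcal D_m}\beta_m(t)|_{\star,\mathcal D_m}\,dt\big)_{m}$ and $\big(\|\nabla_{\mathcal D_m}\zeta_m\|_{L^2(0,T;L^p(\Omega)^d)}\big)_{m}$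 are bounded; - as $m\to\infty$, $\Pi_{\mathcal D_m}\beta_m\to\overline\beta$ and $\Pi_{\mathcal D_m}\zeta_m\to\overline\zeta$ weakly in $L^2(\Omega\times(0,T))$. Then $(\Pi_{\mathcal D_m}\beta_m)(\Pi_{\mathcal D_m}\zeta_m)\to\overline\beta\,\overline\zeta$ in the sense of measures on $\Omega\times(0,T)$; that is, for all $\varphi\in C(\overline\Omega\times[0,T])$, $$\lim_{m\to\infty}\int_0^T\!\!\int_\Omega \Pi_{\mathcal D_m}\beta_m(x,t)\,\Pi_{\mathcal D_m}\zeta_m(x,t)\,\varphi(x,t)\,dx\,dt=\int_0^T\!\!\int_\Omega\overline\beta(x,t)\,\overline\zeta(x,t)\,\varphi(x,t)\,dx\,dt.$$ -/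

import Mathlib

open MeasureTheory Set Filter Topology
open scoped ENNReal NNReal Distributions

universe u

noncomputable section

/-- `ℝ^d` with its Euclidean norm. -/
abbrev Space (d : ℕ) : Type := EuclideanSpace ℝ (Fin d)

/-! ### Sobolev functions -/

/-- `G` is the weak (distributional) gradient of `φ` on `Ω` : for all smooth compactly supported
`η`, `∫_Ω φ ∇η = - ∫_Ω η G`.  It is used only for `φ` and `G` of class `L^p` on `Ω`, `p ≥ 1`. -/
def HasWeakGradient {d : ℕ} (Ω : TopologicalSpace.Opens (Space d))
    (φ : Space d → ℝ) (G : Space d → Space d) : Prop :=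
  ∀ η : 𝓓(Ω, ℝ), ∫ x in (Ω : Set (Space d)), φ x • gradient (η : Space d → ℝ) x =
    - ∫ x in (Ω : Set (Space d)), η x • G x

/-- `φ` belongs to `W^{1,p}_0(Ω)` and its weak gradient is `G`. Here `W^{1,p}_0(Ω)` is the closure
of `C^∞_c(Ω)` in `W^{1,p}(Ω)`. -/
structure MemW10p {d : ℕ} (Ω : TopologicalSpace.Opens (Space d)) (p : ℝ≥0∞)
    (φ : Space d → ℝ) (G : Space d → Space d) : Prop where
  memLp : MemLp φ p (volume.restrict (Ω : Set (Space d)))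
  memLp_grad : MemLp G p (volume.restrict (Ω : Set (Space d)))
  hasWeakGradient : HasWeakGradient Ω φ G
  approx : ∀ ε : ℝ≥0∞, 0 < ε → ∃ f : 𝓓(Ω, ℝ),
    eLpNorm (fun x => φ x - f x) p (volume.restrict (Ω : Set (Space d))) +
      eLpNorm (fun x => G x - gradient (f : Space d → ℝ) x) p
        (volume.restrict (Ω : Set (Space d))) < ε

/-! ### Space-time gradient discretisations -/

/-- A space-time gradient discretisation of `Ω × (0,T)` for homogeneous Dirichlet boundary
conditions. The space of discrete unknowns is `I → ℝ`, with `I` the finite set of degrees of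
freedom. -/
structure GradientDiscretisation {d : ℕ} (Ω : TopologicalSpace.Opens (Space d)) (T : ℝ)
    (p : ℝ≥0∞) : Type (u + 1) where
  /-- the degrees of freedom -/
  I : Type u
  /-- there are finitely many of them -/
  fintypeI : Fintype I
  /-- the sets `Ω_i` on which the reconstructed functions are constant -/
  cell : I → Set (Space d)
  nullMeasurableSet_cell : ∀ i, NullMeasurableSet (cell i) volume
  pairwise_disjoint_cell : Pairwise (fun i j => Disjoint (cell i) (cell j))
  iUnion_cell : ⋃ i, cell i = (Ω : Set (Space d))
  /-- the reconstructed gradient `∇_D` -/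
  grad : (I → ℝ) →ₗ[ℝ] Lp (Space d) p (volume.restrict (Ω : Set (Space d)))
  /-- the seminorm `u ↦ ‖∇_D u‖_{L^p(Ω)^d}` is a norm -/
  eq_zero_of_grad_eq_zero : ∀ u, grad u = 0 → u = 0
  /-- the interpolation operator `I_D` -/
  interp : Lp ℝ 2 (volume.restrict (Ω : Set (Space d))) →ₗ[ℝ] (I → ℝ)
  /-- the number of time steps -/
  N : ℕ
  /-- the times `t^(0) = 0 < t^(1) < ... < t^(N) = T` -/
  time : Fin (N + 1) → ℝ
  time_zero : time 0 = 0
  time_last : time (Fin.last N) = T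
  time_strictMono : StrictMono time

namespace GradientDiscretisation

attribute [instance] GradientDiscretisation.fintypeI

variable {d : ℕ} {Ω : TopologicalSpace.Opens (Space d)} {T : ℝ} {p : ℝ≥0∞}

/-- The piecewise constant reconstruction `Π_D u`, equal to `u_i` on `Ω_i` and, as the `Ω_i` form a
partition of `Ω`, to `0` outside `Ω`. -/
def recon (D : GradientDiscretisation Ω T p) (u : D.I → ℝ) (x : Space d) : ℝ :=
  ∑ i, (D.cell i).indicator (fun _ => u i) x

/-- The norm `‖∇_D u‖_{L^p(Ω)^d}`. -/
def gradNorm (D : GradientDiscretisation Ω T p) (u : D.I → ℝ) : ℝ≥0∞ :=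
  eLpNorm (D.grad u) p (volume.restrict (Ω : Set (Space d)))

/-- The time step `t^(n+1) - t^(n)`. -/
def timeStep (D : GradientDiscretisation Ω T p) (n : Fin D.N) : ℝ :=
  D.time n.succ - D.time n.castSucc

/-- The largest time step. -/
def maxTimeStep (D : GradientDiscretisation Ω T p) : ℝ :=
  ⨆ n : Fin D.N, D.timeStep n

/-- The dual semi-norm
`|w|_{⋆,D} = sup { ∫_Ω Π_D w Π_D z : ‖∇_D z‖_{L^p(Ω)^d} = 1 }`. The set over which the supremum is
taken is symmetric, so that nothing is lost in truncating the integral at `0`; the supremum of the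
empty set (when there is no degree of freedom) is `0`. -/
def dualSeminorm (D : GradientDiscretisation Ω T p) (w : D.I → ℝ) : ℝ≥0∞ :=
  ⨆ (z : D.I → ℝ) (_ : D.gradNorm z = 1),
    ENNReal.ofReal (∫ x in (Ω : Set (Space d)), D.recon w x * D.recon z x)

/-- A family `(v^(n))_{n=0,...,N}` of discrete unknowns as a function of time: `v^(0)` at `t = 0` and
`v^(n+1)` on `(t^(n), t^(n+1)]`. -/
def atTime (D : GradientDiscretisation Ω T p) (v : Fin (D.N + 1) → D.I → ℝ) (t : ℝ) : D.I → ℝ :=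
  ({0} : Set ℝ).indicator (fun _ => v 0) t +
    ∑ n : Fin D.N, (Ioc (D.time n.castSucc) (D.time n.succ)).indicator (fun _ => v n.succ) t

/-- The space-time reconstruction `(x, t) ↦ Π_D v(x, t)`. -/
def stRecon (D : GradientDiscretisation Ω T p) (v : Fin (D.N + 1) → D.I → ℝ)
    (z : Space d × ℝ) : ℝ :=
  D.recon (D.atTime v z.2) z.1

/-- The discrete time derivative `δ_D v(t) = (v^(n+1) - v^(n)) / (t^(n+1) - t^(n))` for
`t ∈ (t^(n), t^(n+1)]`. -/
def discreteDeriv (D : GradientDiscretisation Ω T p) (v : Fin (D.N + 1) → D.I → ℝ) (t : ℝ) :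
    D.I → ℝ :=
  ∑ n : Fin D.N, (Ioc (D.time n.castSucc) (D.time n.succ)).indicator
    (fun _ => (D.timeStep n)⁻¹ • (v n.succ - v n.castSucc)) t

/-- `∫_0^T |δ_D v(t)|_{⋆,D} dt`. -/
def derivDualNorm (D : GradientDiscretisation Ω T p) (v : Fin (D.N + 1) → D.I → ℝ) : ℝ≥0∞ :=
  ∫⁻ t in Ioo 0 T, D.dualSeminorm (D.discreteDeriv v t)

/-- `‖∇_D v‖_{L²(0,T;L^p(Ω)^d)}`. -/
def gradL2Norm (D : GradientDiscretisation Ω T p) (v : Fin (D.N + 1) → D.I → ℝ) : ℝ≥0∞ :=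
  (∫⁻ t in Ioo 0 T, D.gradNorm (D.atTime v t) ^ (2 : ℝ)) ^ (1 / 2 : ℝ)

/-- The consistency defect
`S_D(φ) = min_w (‖Π_D w - φ‖_{L^{max(p,2)}(Ω)} + ‖∇_D w - ∇φ‖_{L^p(Ω)^d})`, where `G = ∇φ`. -/
def consistencyDefect (D : GradientDiscretisation Ω T p) (φ : Space d → ℝ)
    (G : Space d → Space d) : ℝ≥0∞ :=
  ⨅ w : D.I → ℝ,
    (eLpNorm (fun x => D.recon w x - φ x) (max p 2) (volume.restrict (Ω : Set (Space d))) +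
      eLpNorm (fun x => D.grad w x - G x) p (volume.restrict (Ω : Set (Space d))))

/-- The translation modulus
`T_D(ξ) = max_{v ≠ 0} ‖Π_D v(· + ξ) - Π_D v‖_{L^p(ℝ^d)} / ‖∇_D v‖_{L^p(Ω)^d}`. -/
def translationModulus (D : GradientDiscretisation Ω T p) (ξ : Space d) : ℝ≥0∞ :=
  ⨆ (v : D.I → ℝ) (_ : v ≠ 0),
    eLpNorm (fun x => D.recon v (x + ξ) - D.recon v x) p volume / D.gradNorm v

/-- Consistency of a sequence of space-time gradient discretisations. -/
structure IsConsistent (D : ℕ → GradientDiscretisation Ω T p) : Prop where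
  tendsto_defect : ∀ (φ : Space d → ℝ) (G : Space d → Space d),
    MemLp φ 2 (volume.restrict (Ω : Set (Space d))) → MemW10p Ω p φ G →
      Tendsto (fun m => (D m).consistencyDefect φ G) atTop (𝓝 0)
  tendsto_interp : ∀ φ : Lp ℝ 2 (volume.restrict (Ω : Set (Space d))),
    Tendsto (fun m => eLpNorm (fun x => (D m).recon ((D m).interp φ) x - φ x) 2
      (volume.restrict (Ω : Set (Space d)))) atTop (𝓝 0)
  tendsto_timeStep : Tendsto (fun m => (D m).maxTimeStep) atTop (𝓝 0)

/-- Compactness of a sequence of space-time gradient discretisations. -/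
def IsCompactSeq (D : ℕ → GradientDiscretisation Ω T p) : Prop :=
  Tendsto (fun ξ : Space d => ⨆ m, (D m).translationModulus ξ) (𝓝 0) (𝓝 0)

end GradientDiscretisation

/-- Weak convergence in `L²(S)` : `u_m` and `w` are in `L²(S)` and `∫_S u_m ψ → ∫_S w ψ` for all
`ψ ∈ L²(S)`. -/
structure WeakL2Tendsto {α : Type*} [MeasureSpace α] (S : Set α) (u : ℕ → α → ℝ) (w : α → ℝ) :
    Prop where
  memLp : ∀ m, MemLp (u m) 2 (volume.restrict S)
  memLp_limit : MemLp w 2 (volume.restrict S)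
  tendsto : ∀ ψ : α → ℝ, MemLp ψ 2 (volume.restrict S) →
    Tendsto (fun m => ∫ z in S, u m z * ψ z) atTop (𝓝 (∫ z in S, w z * ψ z))

end

noncomputable section

/-! ### Square integrable functions on products -/

section General

variable {α τ : Type*} [MeasurableSpace α] [MeasurableSpace τ]

/-! Neither factor converges strongly, but `β` is compact in time (tested against smooth functions
of space) and `ζ` is compact in space, and this is enough for the product. Put `h_m = Π β_m - βlim`,
which is bounded and weakly null in `L²`. Since `∫ βlim φ Π ζ_m` is linear in `ζ_m` and passes to
the limit, it remains to show `∫ h_m φ Π ζ_m → 0`.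

Time: for every `η ∈ L²(Ω)` the moment `q_m(t) = ∫ h_m(x,t) η(x) dx` tends to zero strongly in
`L²(0,T)`. For a test function `η`, consistency gives `w_m` with `Π w_m → η` in `L²` and bounded
discrete gradients. By duality with `|·|_⋆`, the step function `f_m(t) = ∫ Π β_m(t) Π w_m` has
bounded variation. As `q_m` is weakly null, its tails `∫_s^T q_m` tend to zero uniformly in `s`
(pointwise convergence and a uniform Hölder bound), hence `∫ q_m f_m → 0`
(`tendsto_integral_mul_step`). Up to a strongly null error, `q_m` is `f_m` minus a fixed function,
so `∫ q_m² → 0` (`tendsto_eLpNorm_slicePairing_testFunction`). Density extends this to all `η`.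

Space: for a fixed radius `δ`, the integrals of `h_m` over balls of radius `δ` are moments, so they
tend to zero strongly in space-time (`tendsto_eLpNorm_ballIntegral`). By Fubini, averaging `h_m`
amounts to averaging `φ Π ζ_m`. The error in replacing `φ Π ζ_m` by its average is controlled by its
space translates, which are small with `δ` uniformly in `m` by compactness
(`enorm_integral_ballIntegral_sub_le`). Choosing `δ` first and then `m` concludes. -/

theorem lintegral_mul_le_eLpNorm_two {μ : Measure α} {f g : α → ℝ}
    (hf : AEStronglyMeasurable f μ) (hg : AEStronglyMeasurable g μ) :
    ∫⁻ x, ‖f x * g x‖ₑ ∂μ ≤ eLpNorm f 2 μ * eLpNorm g 2 μ := by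
  have := eLpNorm_smul_le_mul_eLpNorm (p := 2) (q := 2) (r := 1) hg hf
  rwa [eLpNorm_one_eq_lintegral_enorm] at this

theorem enorm_integral_mul_le {μ : Measure α} {f g : α → ℝ}
    (hf : AEStronglyMeasurable f μ) (hg : AEStronglyMeasurable g μ) :
    ‖∫ x, f x * g x ∂μ‖ₑ ≤ eLpNorm f 2 μ * eLpNorm g 2 μ :=
  (enorm_integral_le_lintegral_enorm _).trans (lintegral_mul_le_eLpNorm_two hf hg)

theorem eLpNorm_two_sq {F : Type*} [NormedAddCommGroup F] {μ : Measure α} (f : α → F) :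
    eLpNorm f 2 μ ^ 2 = ∫⁻ x, ‖f x‖ₑ ^ 2 ∂μ := by
  rw [eLpNorm_eq_lintegral_rpow_enorm_toReal (by norm_num) (by norm_num)]
  simp only [ENNReal.toReal_ofNat, ENNReal.rpow_ofNat, one_div]
  rw [← ENNReal.rpow_two, ← ENNReal.rpow_mul]
  norm_num

theorem le_of_ennreal_sq_le_sq {a b : ℝ≥0∞} (h : a ^ 2 ≤ b ^ 2) : a ≤ b :=
  (ENNReal.pow_le_pow_left_iff two_ne_zero).1 h

theorem integrable_mul_of_memLp_two {μ : Measure α} {f g : α → ℝ} (hf : MemLp f 2 μ)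
    (hg : MemLp g 2 μ) : Integrable (fun x => f x * g x) μ :=
  MemLp.integrable_mul hf hg

theorem eLpNorm_prod_two_sq {ν : Measure α} {lam : Measure τ} [SFinite ν] [SFinite lam]
    {f : α × τ → ℝ} (hf : AEStronglyMeasurable f (ν.prod lam)) :
    eLpNorm f 2 (ν.prod lam) ^ 2 = ∫⁻ t, eLpNorm (fun x => f (x, t)) 2 ν ^ 2 ∂lam := by
  simp_rw [eLpNorm_two_sq]
  rw [lintegral_prod_symm]
  exact hf.enorm.pow_const 2

theorem memLp_slice {ν : Measure α} {lam : Measure τ} [SFinite ν] [SFinite lam]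
    {f : α × τ → ℝ} (hf : MemLp f 2 (ν.prod lam)) :
    ∀ᵐ t ∂lam, MemLp (fun x => f (x, t)) 2 ν := by
  have h1 : ∀ᵐ t ∂lam, AEStronglyMeasurable (fun x => f (x, t)) ν :=
    hf.1.prod_swap.prodMk_left
  have h2 : ∀ᵐ t ∂lam, eLpNorm (fun x => f (x, t)) 2 ν ^ 2 < ∞ := by
    refine ae_lt_top' ?_ ?_
    · simp_rw [eLpNorm_two_sq]
      exact (hf.1.enorm.pow_const 2).prod_swap.lintegral_prod_right'
    · rw [← eLpNorm_prod_two_sq hf.1]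
      exact (ENNReal.pow_lt_top hf.2).ne
  filter_upwards [h1, h2] with t h1 h2
  exact ⟨h1, by simpa using h2⟩

/-- The function `t ↦ ∫ f(x,t) η(x) dx`. -/
def slicePairing (ν : Measure α) (f : α × τ → ℝ) (η : α → ℝ) (t : τ) : ℝ :=
  ∫ x, f (x, t) * η x ∂ν

theorem memLp_tensor {ν : Measure α} {lam : Measure τ} [SFinite ν] [SFinite lam]
    {η : α → ℝ} {θ : τ → ℝ} (hη : MemLp η 2 ν) (hθ : MemLp θ 2 lam) :
    MemLp (fun z : α × τ => η z.1 * θ z.2) 2 (ν.prod lam) := by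
  have hm : AEStronglyMeasurable (fun z : α × τ => η z.1 * θ z.2) (ν.prod lam) :=
    hη.1.comp_fst.mul hθ.1.comp_snd
  rw [memLp_two_iff_integrable_sq hm]
  simp_rw [mul_pow]
  exact hη.integrable_sq.mul_prod hθ.integrable_sq

theorem integral_mul_tensor {ν : Measure α} {lam : Measure τ} [SFinite ν] [SFinite lam]
    {f : α × τ → ℝ} {η : α → ℝ} {θ : τ → ℝ} (hf : MemLp f 2 (ν.prod lam))
    (hη : MemLp η 2 ν) (hθ : MemLp θ 2 lam) :
    ∫ z, f z * (η z.1 * θ z.2) ∂(ν.prod lam) = ∫ t, slicePairing ν f η t * θ t ∂lam := by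
  rw [integral_prod_symm _ (integrable_mul_of_memLp_two hf (memLp_tensor hη hθ))]
  refine integral_congr_ae (.of_forall fun t => ?_)
  simp only [slicePairing, ← integral_mul_const, mul_assoc]

theorem aestronglyMeasurable_slicePairing {ν : Measure α} {lam : Measure τ} [SFinite ν]
    [SFinite lam] {f : α × τ → ℝ} {η : α → ℝ} (hf : AEStronglyMeasurable f (ν.prod lam))
    (hη : AEStronglyMeasurable η ν) : AEStronglyMeasurable (slicePairing ν f η) lam :=
  (hf.mul hη.comp_fst).prod_swap.integral_prod_right'

theorem eLpNorm_slicePairing_le {ν : Measure α} {lam : Measure τ} [SFinite ν] [SFinite lam]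
    {f : α × τ → ℝ} {η : α → ℝ} (hf : AEStronglyMeasurable f (ν.prod lam))
    (hη : AEStronglyMeasurable η ν) :
    eLpNorm (slicePairing ν f η) 2 lam ≤ eLpNorm f 2 (ν.prod lam) * eLpNorm η 2 ν := by
  apply le_of_ennreal_sq_le_sq
  rw [mul_pow, eLpNorm_prod_two_sq hf, eLpNorm_two_sq, mul_comm, ← lintegral_const_mul'']
  · refine lintegral_mono_ae ?_
    have h1 : ∀ᵐ t ∂lam, AEStronglyMeasurable (fun x => f (x, t)) ν := hf.prod_swap.prodMk_left
    filter_upwards [h1] with t ht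
    rw [mul_comm, ← mul_pow]
    gcongr
    exact enorm_integral_mul_le ht hη
  · simp_rw [eLpNorm_two_sq]
    exact (hf.enorm.pow_const 2).prod_swap.lintegral_prod_right'

theorem memLp_slicePairing {ν : Measure α} {lam : Measure τ} [SFinite ν] [SFinite lam]
    {f : α × τ → ℝ} {η : α → ℝ} (hf : MemLp f 2 (ν.prod lam)) (hη : MemLp η 2 ν) :
    MemLp (slicePairing ν f η) 2 lam :=
  ⟨aestronglyMeasurable_slicePairing hf.1 hη.1,
    (eLpNorm_slicePairing_le hf.1 hη.1).trans_lt (ENNReal.mul_lt_top hf.2 hη.2)⟩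

/-- Only almost everywhere in `t`: linearity of the integral needs square integrable slices, which
Fubini provides for almost every `t`. -/
theorem slicePairing_sub_left_ae {ν : Measure α} {lam : Measure τ} [SFinite ν] [SFinite lam]
    {f g : α × τ → ℝ} {η : α → ℝ} (hf : MemLp f 2 (ν.prod lam)) (hg : MemLp g 2 (ν.prod lam))
    (hη : MemLp η 2 ν) :
    slicePairing ν (fun z => f z - g z) η =ᵐ[lam]
      fun t => slicePairing ν f η t - slicePairing ν g η t := by
  filter_upwards [memLp_slice hf, memLp_slice hg] with t h1 h2
  simp only [slicePairing, sub_mul]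
  exact integral_sub (integrable_mul_of_memLp_two h1 hη) (integrable_mul_of_memLp_two h2 hη)

theorem slicePairing_sub_right_ae {ν : Measure α} {lam : Measure τ} [SFinite ν] [SFinite lam]
    {f : α × τ → ℝ} {η χ : α → ℝ} (hf : MemLp f 2 (ν.prod lam)) (hη : MemLp η 2 ν)
    (hχ : MemLp χ 2 ν) :
    slicePairing ν f (fun x => η x - χ x) =ᵐ[lam]
      fun t => slicePairing ν f η t - slicePairing ν f χ t := by
  filter_upwards [memLp_slice hf] with t h1
  simp only [slicePairing, mul_sub]
  exact integral_sub (integrable_mul_of_memLp_two h1 hη) (integrable_mul_of_memLp_two h1 hχ)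

/-- A sequence of square integrable functions which converges weakly is bounded. -/
theorem exists_eLpNorm_le_of_weak {μ : Measure α} {u : ℕ → α → ℝ} {w : α → ℝ}
    (hu : ∀ m, MemLp (u m) 2 μ)
    (h : ∀ ψ : α → ℝ, MemLp ψ 2 μ →
      Tendsto (fun m => ∫ z, u m z * ψ z ∂μ) atTop (𝓝 (∫ z, w z * ψ z ∂μ))) :
    ∃ C : ℝ≥0, ∀ m, eLpNorm (u m) 2 μ ≤ C := by
  let U : ℕ → Lp ℝ 2 μ := fun m => (hu m).toLp (u m)
  obtain ⟨C, hC⟩ := banach_steinhaus (g := fun m => innerSL ℝ (U m)) (fun ψ => by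
    have hψ := (h ψ (Lp.memLp ψ)).norm
    obtain ⟨C, hC⟩ := hψ.bddAbove_range
    refine ⟨C, fun m => ?_⟩
    have : innerSL ℝ (U m) ψ = ∫ z, u m z * ψ z ∂μ := by
      rw [innerSL_apply_apply, L2.inner_def]
      refine integral_congr_ae ?_
      filter_upwards [(hu m).coeFn_toLp] with z hz
      simp only [U, hz, RCLike.inner_apply, conj_trivial, mul_comm]
    rw [this]
    exact hC ⟨m, rfl⟩)
  refine ⟨C.toNNReal, fun m => ?_⟩
  have h1 := hC m
  rw [innerSL_apply_norm] at h1
  simp only [U, Lp.norm_toLp] at h1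
  rw [← ENNReal.ofReal_toReal (hu m).2.ne]
  exact ENNReal.ofReal_le_ofReal h1

end General

/-! ### Averages over balls -/

section Ball

variable {d : ℕ}

theorem measurable_ball_indicator (δ : ℝ) :
    Measurable (fun z : Space d × Space d =>
      (Metric.ball z.1 δ).indicator (fun _ => (1 : ℝ)) z.2) := by
  have : (fun z : Space d × Space d => (Metric.ball z.1 δ).indicator (fun _ => (1 : ℝ)) z.2) =
      {z : Space d × Space d | dist z.2 z.1 < δ}.indicator (fun _ => 1) := by
    ext z
    simp [indicator, Metric.mem_ball]
  rw [this]
  exact measurable_const.indicator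
    (isOpen_lt (by fun_prop) continuous_const).measurableSet

theorem norm_ball_indicator_le (y x : Space d) (δ : ℝ) :
    ‖(Metric.ball y δ).indicator (fun _ => (1 : ℝ)) x‖ ≤ 1 := by
  by_cases h : x ∈ Metric.ball y δ <;> simp [h]

theorem aestronglyMeasurable_comp_sub {f : Space d → ℝ} (hf : AEStronglyMeasurable f volume) :
    AEStronglyMeasurable (fun z : Space d × Space d => f (z.1 - z.2)) (volume.prod volume) :=
  hf.comp_quasiMeasurePreserving (quasiMeasurePreserving_sub_of_right_invariant volume volume)

/-- The kernel `1_{|x-y|<δ}` is symmetric, so Fubini moves the ball integral from `h` to the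
extension of `F` by zero. The difference becomes the integral over `ξ` in the ball of `∫ h(x)
(F(x-ξ) - F(x)) dx`, and Cauchy–Schwarz in `x` applies for each `ξ`. The ball integrals are left
unnormalised, so the volume of the ball appears as a factor on both sides. -/
theorem enorm_integral_ball_average_sub_le {U : Set (Space d)} (hU : MeasurableSet U)
    (hfin : volume U < ∞) {h F : Space d → ℝ} (hh : MemLp h 2 (volume.restrict U))
    (hF : MemLp F 2 (volume.restrict U)) {δ : ℝ} {ω : ℝ≥0∞}
    (hω : ∀ ξ ∈ Metric.ball (0 : Space d) δ,
      eLpNorm (fun x => U.indicator F (x - ξ) - F x) 2 (volume.restrict U) ≤ ω) :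
    ‖(∫ y in U, F y * ∫ x in U, h x * (Metric.ball y δ).indicator (fun _ => (1 : ℝ)) x) -
        volume.real (Metric.ball (0 : Space d) δ) * ∫ x in U, h x * F x‖ₑ ≤
      eLpNorm h 2 (volume.restrict U) * ω * volume (Metric.ball (0 : Space d) δ) := by
  set ν := volume.restrict U with hν
  set B := Metric.ball (0 : Space d) δ with hB
  have : IsFiniteMeasure ν := ⟨by simpa [hν] using hfin⟩
  have hBfin : volume B < ∞ := measure_ball_lt_top
  have : IsFiniteMeasure (volume.restrict B) := ⟨by simpa using hBfin⟩
  let k : Space d → Space d → ℝ := fun y x => (Metric.ball y δ).indicator (fun _ => (1 : ℝ)) x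
  have hFi : Integrable F ν := hF.integrable (by norm_num)
  have hhi : Integrable h ν := hh.integrable (by norm_num)
  have hFt : Integrable (U.indicator F) volume := (integrable_indicator_iff hU).2 hFi
  have hint : Integrable (fun z : Space d × Space d => F z.1 * (h z.2 * k z.1 z.2))
      (ν.prod ν) := by
    simp_rw [← mul_assoc]
    exact (hFi.mul_prod hhi).mul_bdd (c := 1) (measurable_ball_indicator δ).aestronglyMeasurable
      (.of_forall fun z => norm_ball_indicator_le _ _ _)
  -- Substitution `y = x - ξ`, after extending `F` by zero to the whole space.
  have hinner : ∀ x, ∫ y, F y * k y x ∂ν = ∫ ξ in B, U.indicator F (x - ξ) := by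
    intro x
    calc ∫ y, F y * k y x ∂ν = ∫ y, U.indicator F y * k y x := by
          rw [hν, ← integral_indicator hU]
          congr 1 with y
          by_cases hy : y ∈ U <;> simp [hy]
      _ = ∫ ξ, U.indicator F (x - ξ) * k (x - ξ) x :=
          (integral_sub_left_eq_self (fun y => U.indicator F y * k y x) volume x).symm
      _ = ∫ ξ in B, U.indicator F (x - ξ) := by
          rw [← integral_indicator (hB ▸ measurableSet_ball)]
          congr 1 with ξ
          have : x ∈ Metric.ball (x - ξ) δ ↔ ξ ∈ B := by simp [hB, dist_eq_norm]
          by_cases hξ : ξ ∈ B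
          · simp [k, this.2 hξ, hξ]
          · simp [k, mt this.1 hξ, hξ]
  have hswap : ∫ y, F y * (∫ x, h x * k y x ∂ν) ∂ν =
      ∫ x, h x * (∫ ξ in B, U.indicator F (x - ξ)) ∂ν := by
    simp_rw [← integral_const_mul]
    rw [integral_integral_swap hint]
    refine integral_congr_ae (.of_forall fun x => ?_)
    simp only [integral_const_mul, ← hinner]
    rw [← integral_const_mul]
    congr 1 with y
    ring
  have hint2 : Integrable (fun x => h x * (∫ ξ in B, U.indicator F (x - ξ))) ν := by
    refine hint.integral_prod_right.congr (.of_forall fun x => ?_)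
    simp only [← hinner]
    rw [← integral_const_mul]
    congr 1 with y
    ring
  have hdiff : (∫ y, F y * (∫ x, h x * k y x ∂ν) ∂ν) - volume.real B * ∫ x, h x * F x ∂ν =
      ∫ x, h x * (∫ ξ in B, (U.indicator F (x - ξ) - F x)) ∂ν := by
    rw [hswap, ← integral_const_mul, ← integral_sub hint2
      ((integrable_mul_of_memLp_two hh hF).const_mul _)]
    refine integral_congr_ae (.of_forall fun x => ?_)
    simp only
    rw [integral_sub (hFt.comp_sub_left x).integrableOn (integrable_const _)]
    simp [Measure.real]
    ring
  rw [hdiff]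
  have hmeas : AEMeasurable (Function.uncurry fun x ξ => ‖h x * (U.indicator F (x - ξ) - F x)‖ₑ)
      (ν.prod (volume.restrict B)) := by
    refine AEStronglyMeasurable.enorm ?_
    refine hhi.1.comp_fst.mul (AEStronglyMeasurable.sub ?_ hFi.1.comp_fst)
    rw [hν, Measure.prod_restrict]
    exact (aestronglyMeasurable_comp_sub hFt.1).restrict
  calc _ ≤ ∫⁻ x, ‖h x * (∫ ξ in B, (U.indicator F (x - ξ) - F x))‖ₑ ∂ν :=
        enorm_integral_le_lintegral_enorm _
    _ ≤ ∫⁻ x, (∫⁻ ξ in B, ‖h x * (U.indicator F (x - ξ) - F x)‖ₑ) ∂ν := by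
        refine lintegral_mono fun x => ?_
        rw [← integral_const_mul]
        exact enorm_integral_le_lintegral_enorm _
    _ = ∫⁻ ξ in B, (∫⁻ x, ‖h x * (U.indicator F (x - ξ) - F x)‖ₑ ∂ν) :=
        lintegral_lintegral_swap hmeas
    _ ≤ ∫⁻ ξ in B, eLpNorm h 2 ν * ω := by
        refine setLIntegral_mono measurable_const fun ξ hξ => ?_
        refine (lintegral_mul_le_eLpNorm_two hhi.1 (AEStronglyMeasurable.sub ?_ hFi.1)).trans
          (mul_le_mul_right (hω ξ hξ) _)
        exact (hFt.comp_sub_right ξ).1.restrict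
    _ = _ := by simp

end Ball

/-! ### Weakly null functions of time against step functions of bounded variation -/

section Time

variable {T : ℝ}

theorem memLp_Ioi_indicator (s : ℝ) :
    MemLp ((Ioi s).indicator fun _ => (1 : ℝ)) 2 (volume.restrict (Ioo 0 T)) :=
  (memLp_const 1).indicator measurableSet_Ioi

theorem eLpNorm_Ioi_indicator_sub_le {s s' : ℝ} (h : s ≤ s') :
    eLpNorm (fun t => (Ioi s).indicator (fun _ => (1 : ℝ)) t -
      (Ioi s').indicator (fun _ => (1 : ℝ)) t) 2 (volume.restrict (Ioo 0 T)) ≤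
      ENNReal.ofReal (√(s' - s)) := by
  have : (fun t => (Ioi s).indicator (fun _ => (1 : ℝ)) t -
      (Ioi s').indicator (fun _ => (1 : ℝ)) t) = (Ioc s s').indicator fun _ => (1 : ℝ) := by
    ext t
    by_cases h1 : s < t <;> by_cases h2 : s' < t <;> simp [indicator, h1, h2, not_lt.1, not_le.2]
    linarith
  rw [this, eLpNorm_indicator_const measurableSet_Ioc (by norm_num) (by norm_num)]
  simp only [enorm_one, one_mul, ENNReal.toReal_ofNat]
  rw [Real.sqrt_eq_rpow, ← ENNReal.ofReal_rpow_of_nonneg (by linarith) (by norm_num)]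
  gcongr
  exact (Measure.restrict_apply_le _ _).trans (by simp)

/-- By Cauchy–Schwarz the tails `s ↦ ∫_s^T q_m` are Hölder continuous of exponent 1/2 with the
common constant `M`. Pointwise convergence on a finite net of `[0,T]` therefore gives uniform
convergence. -/
theorem eventually_forall_abs_tail_le {q : ℕ → ℝ → ℝ} {M : ℝ≥0}
    (hq : ∀ m, MemLp (q m) 2 (volume.restrict (Ioo 0 T)))
    (hM : ∀ m, eLpNorm (q m) 2 (volume.restrict (Ioo 0 T)) ≤ M)
    (h0 : ∀ s ∈ Icc 0 T, Tendsto
      (fun m => ∫ t in Ioo 0 T, q m t * (Ioi s).indicator (fun _ => (1 : ℝ)) t) atTop (𝓝 0))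
    {ε : ℝ} (hε : 0 < ε) :
    ∀ᶠ m in atTop, ∀ s ∈ Icc 0 T,
      |∫ t in Ioo 0 T, q m t * (Ioi s).indicator (fun _ => (1 : ℝ)) t| ≤ ε := by
  set K : ℕ → ℝ → ℝ := fun m s =>
    ∫ t in Ioo 0 T, q m t * (Ioi s).indicator (fun _ => (1 : ℝ)) t with hK
  have hsub : ∀ m s s', s ≤ s' → |K m s - K m s'| ≤ M * √(s' - s) := by
    intro m s s' h
    have e : K m s - K m s' = ∫ t in Ioo 0 T, q m t * ((Ioi s).indicator (fun _ => (1 : ℝ)) t -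
        (Ioi s').indicator (fun _ => (1 : ℝ)) t) := by
      simp_rw [mul_sub]
      exact (integral_sub (integrable_mul_of_memLp_two (hq m) (memLp_Ioi_indicator s))
        (integrable_mul_of_memLp_two (hq m) (memLp_Ioi_indicator s'))).symm
    have := (enorm_integral_mul_le (hq m).1
      ((memLp_Ioi_indicator (T := T) s).sub (memLp_Ioi_indicator s')).1).trans
      (mul_le_mul' (hM m) (eLpNorm_Ioi_indicator_sub_le h))
    rw [e, ← Real.norm_eq_abs, ← ENNReal.ofReal_le_ofReal_iff (by positivity), ofReal_norm,
      ENNReal.ofReal_mul (by positivity), ENNReal.ofReal_coe_nnreal]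
    exact this
  have hsub' : ∀ m s s', |K m s - K m s'| ≤ M * √|s' - s| := by
    intro m s s'
    rcases le_total s s' with h | h
    · rw [abs_of_nonneg (by linarith : (0 : ℝ) ≤ s' - s)]
      exact hsub m s s' h
    · rw [abs_sub_comm s' s, abs_of_nonneg (by linarith : (0 : ℝ) ≤ s - s'), abs_sub_comm (K m s)]
      exact hsub m s' s h
  -- Mesh for which the Hölder bound gives `M √δ ≤ ε / 2`; `M + 1` avoids dividing by zero.
  set δ : ℝ := (ε / 2 / (M + 1)) ^ 2 with hδ
  have hM1 : (0 : ℝ) < M + 1 := by positivity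
  obtain ⟨A, hA, hfin, hcov⟩ := (isCompact_Icc (a := (0 : ℝ)) (b := T)).finite_cover_balls
    (e := δ) (by positivity)
  have hev : ∀ᶠ m in atTop, ∀ s ∈ A, |K m s| < ε / 2 := by
    refine (Filter.eventually_all_finite hfin).2 fun s hs => ?_
    have := (h0 s (hA hs)).abs
    rw [abs_zero] at this
    exact this.eventually_lt_const (by positivity)
  filter_upwards [hev] with m hm s hs
  obtain ⟨a, haA, ha⟩ := mem_iUnion₂.1 (hcov hs)
  rw [Metric.mem_ball, Real.dist_eq] at ha
  have h1 : √|a - s| ≤ ε / 2 / (M + 1) := by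
    rw [Real.sqrt_le_left (by positivity), abs_sub_comm]
    exact ha.le
  have h2 : (M : ℝ) * √|a - s| ≤ ε / 2 := by
    calc (M : ℝ) * √|a - s| ≤ (M + 1) * (ε / 2 / (M + 1)) := by gcongr; linarith
      _ = ε / 2 := by field_simp
  have h3 := hsub' m s a
  have h4 := hm a haA
  have h5 : |K m s| ≤ |K m s - K m a| + |K m a| := by
    simpa using abs_add_le (K m s - K m a) (K m a)
  change |K m s| ≤ ε
  linarith

/-- A weakly null bounded sequence in `L²(0,T)`, paired with step functions whose variations and
norms are bounded, tends to zero. -/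
theorem tendsto_integral_mul_step (hT : 0 < T) {q f : ℕ → ℝ → ℝ} {M M' : ℝ≥0} {A : ℝ}
    (hq : ∀ m, MemLp (q m) 2 (volume.restrict (Ioo 0 T)))
    (hM : ∀ m, eLpNorm (q m) 2 (volume.restrict (Ioo 0 T)) ≤ M)
    (h0 : ∀ s ∈ Icc 0 T, Tendsto
      (fun m => ∫ t in Ioo 0 T, q m t * (Ioi s).indicator (fun _ => (1 : ℝ)) t) atTop (𝓝 0))
    (hf : ∀ m, MemLp (f m) 2 (volume.restrict (Ioo 0 T)))
    (hM' : ∀ m, eLpNorm (f m) 2 (volume.restrict (Ioo 0 T)) ≤ M')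
    {N : ℕ → ℕ} {τ a : (m : ℕ) → Fin (N m) → ℝ} {c : ℕ → ℝ}
    (hτ : ∀ m n, τ m n ∈ Icc 0 T) (ha : ∀ m, ∑ n, |a m n| ≤ A)
    (hrep : ∀ m, ∀ t ∈ Ioo 0 T, f m t =
      c m + ∑ n, a m n * (Ioi (τ m n)).indicator (fun _ => (1 : ℝ)) t) :
    Tendsto (fun m => ∫ t in Ioo 0 T, q m t * f m t) atTop (𝓝 0) := by
  have hA : 0 ≤ A := (Finset.sum_nonneg fun n _ => abs_nonneg _).trans (ha 0)
  set lam := volume.restrict (Ioo 0 T) with hlam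
  have hlamT : lam univ = ENNReal.ofReal T := by simp [hlam]
  -- the constants are bounded
  obtain ⟨C, hC⟩ : ∃ C : ℝ, ∀ m, |c m| ≤ C := by
    -- The bound comes from integrating `|c m| ≤ |f m t| + A` over `(0,T)`, with Cauchy–Schwarz for
    -- `f m`.
    refine ⟨T⁻¹ * (M' * √T + A * T), fun m => ?_⟩
    have hpt : ∀ t ∈ Ioo 0 T, ‖c m‖ₑ ≤ ‖f m t * 1‖ₑ + ENNReal.ofReal A := by
      intro t ht
      rw [← ofReal_norm, ← ofReal_norm, ← ENNReal.ofReal_add (norm_nonneg _) hA]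
      refine ENNReal.ofReal_le_ofReal ?_
      have h1 : c m = f m t - ∑ n, a m n * (Ioi (τ m n)).indicator (fun _ => (1 : ℝ)) t := by
        rw [hrep m t ht]; ring
      have h2 : |∑ n, a m n * (Ioi (τ m n)).indicator (fun _ => (1 : ℝ)) t| ≤ A := by
        refine (Finset.abs_sum_le_sum_abs _ _).trans ((Finset.sum_le_sum fun n _ => ?_).trans
          (ha m))
        by_cases h : τ m n < t <;> simp [indicator, h]
      rw [mul_one, Real.norm_eq_abs, Real.norm_eq_abs]
      calc |c m| ≤ |f m t| + |∑ n, a m n * (Ioi (τ m n)).indicator (fun _ => (1 : ℝ)) t| := by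
            rw [h1]; exact abs_sub _ _
        _ ≤ _ := by gcongr
    have hone : eLpNorm (fun _ : ℝ => (1 : ℝ)) 2 lam = ENNReal.ofReal (√T) := by
      rw [eLpNorm_const' _ (by norm_num) (by norm_num), hlamT, Real.sqrt_eq_rpow,
        ← ENNReal.ofReal_rpow_of_nonneg hT.le (by norm_num)]
      simp
    have hint : ‖c m‖ₑ * ENNReal.ofReal T ≤
        M' * ENNReal.ofReal (√T) + ENNReal.ofReal A * ENNReal.ofReal T := by
      calc ‖c m‖ₑ * ENNReal.ofReal T = ∫⁻ t in Ioo 0 T, ‖c m‖ₑ := by simp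
        _ ≤ ∫⁻ t in Ioo 0 T, (‖f m t * 1‖ₑ + ENNReal.ofReal A) :=
            setLIntegral_mono' measurableSet_Ioo hpt
        _ = (∫⁻ t in Ioo 0 T, ‖f m t * 1‖ₑ) + ENNReal.ofReal A * ENNReal.ofReal T := by
            rw [lintegral_add_right _ measurable_const]; simp
        _ ≤ _ := by
            gcongr
            refine (lintegral_mul_le_eLpNorm_two (hf m).1 aestronglyMeasurable_const).trans ?_
            rw [hone]
            gcongr
            exact hM' m
    rw [← ofReal_norm, ← ENNReal.ofReal_mul (norm_nonneg _), ← ENNReal.ofReal_mul hA,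
      ← ENNReal.ofReal_coe_nnreal, ← ENNReal.ofReal_mul (by positivity),
      ← ENNReal.ofReal_add (by positivity) (by positivity),
      ENNReal.ofReal_le_ofReal_iff (by positivity)] at hint
    rw [← div_eq_inv_mul, le_div_iff₀ hT]
    exact hint
  have hC0 : 0 ≤ C := (abs_nonneg _).trans (hC 0)
  rw [Metric.tendsto_atTop']
  intro ε hε
  have hε' : 0 < ε / 2 / (C + A + 1) := by positivity
  obtain ⟨m₀, hm₀⟩ := eventually_atTop.1 (eventually_forall_abs_tail_le hq hM h0 hε')
  refine ⟨m₀, fun m hm => ?_⟩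
  have hK := hm₀ m hm.le
  have hi : ∀ s, Integrable (fun t => q m t * (Ioi s).indicator (fun _ => (1 : ℝ)) t) lam :=
    fun s => integrable_mul_of_memLp_two (hq m) (memLp_Ioi_indicator s)
  -- The constant `c m` is treated as one more jump, at time `0`, so that the tail bound covers
  -- every term.
  have e : ∫ t in Ioo 0 T, q m t * f m t =
      c m * (∫ t in Ioo 0 T, q m t * (Ioi 0).indicator (fun _ => (1 : ℝ)) t) +
        ∑ n, a m n * ∫ t in Ioo 0 T, q m t * (Ioi (τ m n)).indicator (fun _ => (1 : ℝ)) t := by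
    simp_rw [← integral_const_mul]
    rw [← integral_finsetSum _ fun n _ => (hi _).const_mul _,
      ← integral_add ((hi _).const_mul _) (integrable_finsetSum _ fun n _ => (hi _).const_mul _)]
    refine setIntegral_congr_fun measurableSet_Ioo fun t ht => ?_
    rw [hrep m t ht, indicator_of_mem (show t ∈ Ioi (0 : ℝ) from ht.1), mul_add, Finset.mul_sum]
    congr 1
    · ring
    · exact Finset.sum_congr rfl fun n _ => by ring
  rw [dist_zero_right, Real.norm_eq_abs, e]
  calc _ ≤ |c m| * |∫ t in Ioo 0 T, q m t * (Ioi 0).indicator (fun _ => (1 : ℝ)) t| +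
        ∑ n, |a m n| * |∫ t in Ioo 0 T, q m t * (Ioi (τ m n)).indicator (fun _ => (1 : ℝ)) t| := by
        refine (abs_add_le _ _).trans (add_le_add (abs_mul _ _).le
          ((Finset.abs_sum_le_sum_abs _ _).trans (Finset.sum_le_sum fun n _ => (abs_mul _ _).le)))
    _ ≤ C * (ε / 2 / (C + A + 1)) + ∑ n, |a m n| * (ε / 2 / (C + A + 1)) := by
        gcongr with n
        · exact hC m
        · exact hK 0 ⟨le_rfl, hT.le⟩
        · exact hK _ (hτ m n)
    _ ≤ C * (ε / 2 / (C + A + 1)) + A * (ε / 2 / (C + A + 1)) := by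
        rw [← Finset.sum_mul]
        gcongr
        exact ha m
    _ ≤ (C + A + 1) * (ε / 2 / (C + A + 1)) := by
        rw [← add_mul]
        exact mul_le_mul_of_nonneg_right (by linarith) hε'.le
    _ = ε / 2 := by field_simp
    _ < ε := by linarith

end Time

/-! ### Elementary properties of gradient discretisations -/

namespace GradientDiscretisation

variable {d : ℕ} {Ω : TopologicalSpace.Opens (Space d)} {T : ℝ} {p : ℝ≥0∞}

theorem recon_add (D : GradientDiscretisation.{u} Ω T p) (u v : D.I → ℝ) (x : Space d) :
    D.recon (u + v) x = D.recon u x + D.recon v x := by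
  simp only [recon, ← Finset.sum_add_distrib]
  refine Finset.sum_congr rfl fun i _ => ?_
  by_cases h : x ∈ D.cell i <;> simp [h]

theorem recon_smul (D : GradientDiscretisation.{u} Ω T p) (c : ℝ) (u : D.I → ℝ) (x : Space d) :
    D.recon (c • u) x = c * D.recon u x := by
  simp only [recon, Finset.mul_sum]
  refine Finset.sum_congr rfl fun i _ => ?_
  by_cases h : x ∈ D.cell i <;> simp [h]

/-- Reconstruction at a point, as a linear map. -/
def reconAt (D : GradientDiscretisation.{u} Ω T p) (x : Space d) : (D.I → ℝ) →ₗ[ℝ] ℝ where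
  toFun u := D.recon u x
  map_add' u v := D.recon_add u v x
  map_smul' c u := D.recon_smul c u x

theorem recon_eq_zero (D : GradientDiscretisation.{u} Ω T p) (u : D.I → ℝ) {x : Space d}
    (hx : x ∉ (Ω : Set (Space d))) : D.recon u x = 0 := by
  refine Finset.sum_eq_zero fun i _ => indicator_of_notMem (fun h => hx ?_) _
  rw [← D.iUnion_cell]
  exact mem_iUnion_of_mem i h

theorem aestronglyMeasurable_recon (D : GradientDiscretisation.{u} Ω T p) (u : D.I → ℝ) :
    AEStronglyMeasurable (D.recon u) volume := by
  have : D.recon u = ∑ i, (D.cell i).indicator fun _ => u i := by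
    ext x
    simp [recon]
  rw [this]
  exact Finset.aestronglyMeasurable_sum _ fun i _ =>
    aestronglyMeasurable_const.indicator₀ (D.nullMeasurableSet_cell i)

theorem abs_recon_le (D : GradientDiscretisation.{u} Ω T p) (u : D.I → ℝ) (x : Space d) :
    |D.recon u x| ≤ ∑ i, |u i| := by
  refine (Finset.abs_sum_le_sum_abs _ _).trans (Finset.sum_le_sum fun i _ => ?_)
  by_cases h : x ∈ D.cell i <;> simp [h]

theorem memLp_recon (D : GradientDiscretisation.{u} Ω T p)
    (hΩ : volume (Ω : Set (Space d)) < ∞) (u : D.I → ℝ) (q : ℝ≥0∞) :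
    MemLp (D.recon u) q (volume.restrict (Ω : Set (Space d))) := by
  have : IsFiniteMeasure (volume.restrict (Ω : Set (Space d))) := ⟨by simpa using hΩ⟩
  exact MemLp.of_bound (D.aestronglyMeasurable_recon u).restrict _
    (.of_forall fun x => D.abs_recon_le u x)

theorem gradNorm_zero (D : GradientDiscretisation.{u} Ω T p) : D.gradNorm 0 = 0 := by
  rw [gradNorm, map_zero, eLpNorm_congr_ae (Lp.coeFn_zero _ _ _), eLpNorm_zero]

theorem gradNorm_ne_top (D : GradientDiscretisation.{u} Ω T p) (u : D.I → ℝ) :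
    D.gradNorm u ≠ ∞ :=
  (Lp.memLp (D.grad u)).2.ne

theorem gradNorm_eq_zero_iff (D : GradientDiscretisation.{u} Ω T p) (hp : p ≠ 0)
    (u : D.I → ℝ) : D.gradNorm u = 0 ↔ u = 0 := by
  refine ⟨fun h => D.eq_zero_of_grad_eq_zero u ?_, fun h => by rw [h, gradNorm_zero]⟩
  rw [Lp.eq_zero_iff_ae_eq_zero]
  exact (eLpNorm_eq_zero_iff (Lp.memLp _).1 hp).1 h

theorem gradNorm_smul (D : GradientDiscretisation.{u} Ω T p) (c : ℝ) (u : D.I → ℝ) :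
    D.gradNorm (c • u) = ‖c‖ₑ * D.gradNorm u := by
  rw [gradNorm, map_smul, eLpNorm_congr_ae (Lp.coeFn_smul _ _), eLpNorm_const_smul, gradNorm]

theorem measurable_gradNorm (D : GradientDiscretisation.{u} Ω T p) (hp : 1 ≤ p) :
    Measurable D.gradNorm := by
  have : Fact (1 ≤ p) := ⟨hp⟩
  have h : D.gradNorm = fun u => ‖D.grad u‖ₑ := by
    ext u
    rw [Lp.enorm_def, gradNorm]
  rw [h]
  exact (LinearMap.continuous_of_finiteDimensional D.grad).enorm.measurable

theorem measurable_atTime (D : GradientDiscretisation.{u} Ω T p)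
    (v : Fin (D.N + 1) → D.I → ℝ) : Measurable (D.atTime v) := by
  unfold atTime
  refine (measurable_const.indicator (measurableSet_singleton 0)).add ?_
  exact Finset.measurable_sum _ fun n _ => measurable_const.indicator measurableSet_Ioc

theorem gradL2Norm_sq (D : GradientDiscretisation.{u} Ω T p) (v : Fin (D.N + 1) → D.I → ℝ) :
    D.gradL2Norm v ^ 2 = ∫⁻ t in Ioo 0 T, D.gradNorm (D.atTime v t) ^ 2 := by
  simp only [gradL2Norm, ENNReal.rpow_ofNat]
  rw [← ENNReal.rpow_two, ← ENNReal.rpow_mul]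
  norm_num

/-- Homogeneity: a nonzero `z` is normalised by its gradient norm, which is positive because the
discrete gradient is injective. Replacing `z` by `-z` makes the integral nonnegative. -/
theorem ofReal_abs_integral_le_dualSeminorm_mul (D : GradientDiscretisation.{u} Ω T p)
    (hp : p ≠ 0) (w z : D.I → ℝ) :
    ENNReal.ofReal |∫ x in (Ω : Set (Space d)), D.recon w x * D.recon z x| ≤
      D.dualSeminorm w * D.gradNorm z := by
  wlog hpos : 0 ≤ ∫ x in (Ω : Set (Space d)), D.recon w x * D.recon z x generalizing z
  · have hneg : ∀ x, D.recon w x * D.recon ((-1 : ℝ) • z) x = -(D.recon w x * D.recon z x) := by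
      intro x
      rw [recon_smul]
      ring
    have := this ((-1 : ℝ) • z) (by
      simp_rw [hneg, integral_neg]
      linarith)
    simp_rw [hneg, integral_neg, abs_neg, gradNorm_smul] at this
    simpa using this
  rw [abs_of_nonneg hpos]
  by_cases hz : z = 0
  · subst hz
    have : ∀ x, D.recon (0 : D.I → ℝ) x = 0 := fun x => (D.reconAt x).map_zero
    simp [this]
  have h0 : D.gradNorm z ≠ 0 := mt (D.gradNorm_eq_zero_iff hp z).1 hz
  have ht := D.gradNorm_ne_top z
  set c := (D.gradNorm z).toReal with hc
  have hcpos : 0 < c := ENNReal.toReal_pos h0 ht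
  have hgc : D.gradNorm z = ENNReal.ofReal c := (ENNReal.ofReal_toReal ht).symm
  have h1 : D.gradNorm (c⁻¹ • z) = 1 := by
    rw [gradNorm_smul, hgc, Real.enorm_eq_ofReal (by positivity),
      ← ENNReal.ofReal_mul (by positivity), inv_mul_cancel₀ hcpos.ne', ENNReal.ofReal_one]
  have h2 : ENNReal.ofReal (∫ x in (Ω : Set (Space d)), D.recon w x * D.recon (c⁻¹ • z) x) ≤
      D.dualSeminorm w :=
    le_iSup₂_of_le (f := fun (z : D.I → ℝ) (_ : D.gradNorm z = 1) =>
      ENNReal.ofReal (∫ x in (Ω : Set (Space d)), D.recon w x * D.recon z x)) _ h1 le_rfl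
  have h3 : ∫ x in (Ω : Set (Space d)), D.recon w x * D.recon z x =
      (∫ x in (Ω : Set (Space d)), D.recon w x * D.recon (c⁻¹ • z) x) * c := by
    rw [← integral_mul_const]
    congr 1 with x
    rw [recon_smul]
    field_simp
  rw [h3, ENNReal.ofReal_mul' hcpos.le, hgc]
  gcongr

theorem timeStep_pos (D : GradientDiscretisation.{u} Ω T p) (n : Fin D.N) : 0 < D.timeStep n :=
  sub_pos.2 (D.time_strictMono n.castSucc_lt_succ)

theorem time_mem_Icc (D : GradientDiscretisation.{u} Ω T p) (n : Fin (D.N + 1)) :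
    D.time n ∈ Icc 0 T :=
  ⟨D.time_zero.symm.le.trans (D.time_strictMono.monotone (Fin.zero_le n)),
    (D.time_strictMono.monotone (Fin.le_last n)).trans D.time_last.le⟩

theorem pairwise_disjoint_Ioc_time (D : GradientDiscretisation.{u} Ω T p) :
    Pairwise (Function.onFun Disjoint fun n : Fin D.N =>
      Ioc (D.time n.castSucc) (D.time n.succ)) := by
  refine (pairwise_disjoint_on _).2 fun m n hmn => ?_
  rw [Set.Ioc_disjoint_Ioc]
  exact (min_le_left _ _).trans
    ((D.time_strictMono.monotone (Fin.succ_le_castSucc_iff.2 hmn)).trans (le_max_right _ _))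

theorem discreteDeriv_eq (D : GradientDiscretisation.{u} Ω T p) (v : Fin (D.N + 1) → D.I → ℝ)
    (n : Fin D.N) {t : ℝ} (ht : t ∈ Ioc (D.time n.castSucc) (D.time n.succ)) :
    D.discreteDeriv v t = (D.timeStep n)⁻¹ • (v n.succ - v n.castSucc) := by
  unfold discreteDeriv
  rw [Finset.sum_eq_single n]
  · rw [indicator_of_mem ht]
  · intro k _ hk
    exact indicator_of_notMem
      (fun h => Set.disjoint_left.1 (D.pairwise_disjoint_Ioc_time hk) h ht) _
  · simp

/-- The discrete derivative is constant on each of the disjoint intervals `(t^(n), t^(n+1)]`, all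
contained in `(0,T]`. The endpoint `T` is a null set. -/
theorem sum_dualSeminorm_le_derivDualNorm (D : GradientDiscretisation.{u} Ω T p)
    (v : Fin (D.N + 1) → D.I → ℝ) :
    ∑ n, D.dualSeminorm ((D.timeStep n)⁻¹ • (v n.succ - v n.castSucc)) *
      ENNReal.ofReal (D.timeStep n) ≤ D.derivDualNorm v := by
  calc _ = ∑ n : Fin D.N, ∫⁻ t in Ioc (D.time n.castSucc) (D.time n.succ),
        D.dualSeminorm (D.discreteDeriv v t) := by
        refine Finset.sum_congr rfl fun n _ => ?_
        rw [setLIntegral_congr_fun measurableSet_Ioc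
          (g := fun _ => D.dualSeminorm ((D.timeStep n)⁻¹ • (v n.succ - v n.castSucc)))
          fun t ht => by simp only [D.discreteDeriv_eq v n ht]]
        simp [timeStep]
    _ = ∫⁻ t in ⋃ n : Fin D.N, Ioc (D.time n.castSucc) (D.time n.succ),
        D.dualSeminorm (D.discreteDeriv v t) := by
        rw [lintegral_iUnion (fun _ => measurableSet_Ioc) D.pairwise_disjoint_Ioc_time,
          tsum_fintype]
    _ ≤ ∫⁻ t in Ioc 0 T, D.dualSeminorm (D.discreteDeriv v t) :=
        lintegral_mono_set (iUnion_subset fun n =>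
          Ioc_subset_Ioc (D.time_mem_Icc _).1 (D.time_mem_Icc _).2)
    _ = D.derivDualNorm v := by rw [derivDualNorm, restrict_Ioo_eq_restrict_Ioc]

/-- The terms are the jumps of `t ↦ ∫ Π v(t) Π w`, so this bounds its total variation. Each jump is
the time step times the pairing of the discrete derivative with `w`, to which duality applies. -/
theorem sum_abs_integral_jump_le (D : GradientDiscretisation.{u} Ω T p) (hp : p ≠ 0)
    (v : Fin (D.N + 1) → D.I → ℝ) (w : D.I → ℝ) {C W : ℝ≥0} (hC : D.derivDualNorm v ≤ C)
    (hW : D.gradNorm w ≤ W) :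
    ∑ n : Fin D.N, |∫ x in (Ω : Set (Space d)),
      D.recon (v n.succ - v n.castSucc) x * D.recon w x| ≤ C * W := by
  rw [← ENNReal.ofReal_le_ofReal_iff (by positivity),
    ENNReal.ofReal_sum_of_nonneg fun _ _ => abs_nonneg _, ENNReal.ofReal_mul (by positivity),
    ENNReal.ofReal_coe_nnreal, ENNReal.ofReal_coe_nnreal]
  refine le_trans ?_ (mul_le_mul' ((D.sum_dualSeminorm_le_derivDualNorm v).trans hC) hW)
  rw [Finset.sum_mul]
  refine Finset.sum_le_sum fun n _ => ?_
  have hs := D.timeStep_pos n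
  have h := D.ofReal_abs_integral_le_dualSeminorm_mul hp
    ((D.timeStep n)⁻¹ • (v n.succ - v n.castSucc)) w
  have e : |∫ x in (Ω : Set (Space d)), D.recon (v n.succ - v n.castSucc) x * D.recon w x| =
      |∫ x in (Ω : Set (Space d)),
        D.recon ((D.timeStep n)⁻¹ • (v n.succ - v n.castSucc)) x * D.recon w x| *
        D.timeStep n := by
    simp_rw [recon_smul, mul_assoc]
    rw [integral_const_mul, abs_mul, abs_inv, abs_of_pos hs]
    field_simp
  rw [e, ENNReal.ofReal_mul' hs.le, mul_right_comm]
  gcongr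

/-- Abel summation: a piecewise constant function is its initial value plus its jumps, each switched
on at the left end of its interval. -/
theorem atTime_eq (D : GradientDiscretisation.{u} Ω T p) (v : Fin (D.N + 1) → D.I → ℝ)
    {t : ℝ} (ht : t ∈ Ioo 0 T) :
    D.atTime v t = v 0 + ∑ n : Fin D.N,
      (Ioi (D.time n.castSucc)).indicator (fun _ => (1 : ℝ)) t • (v n.succ - v n.castSucc) := by
  let g : Fin (D.N + 1) → D.I → ℝ := fun n =>
    (Ioi (D.time n)).indicator (fun _ => (1 : ℝ)) t • v n
  -- The sum telescopes to `g 0 - g (last)`; the first is `v 0` since `t > 0`, the second vanishes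
  -- since `t < T`.
  have htel : ∑ n : Fin D.N, (g n.castSucc - g n.succ) = v 0 := by
    have h1 := Fin.sum_univ_succ g
    rw [Fin.sum_univ_castSucc] at h1
    have hg0 : g 0 = v 0 := by simp [g, D.time_zero, ht.1]
    have hgl : g (Fin.last D.N) = 0 := by simp [g, D.time_last, ht.2.le]
    rw [hg0, hgl, add_zero] at h1
    rw [Finset.sum_sub_distrib, h1, add_sub_cancel_right]
  rw [← htel, ← Finset.sum_add_distrib]
  unfold atTime
  rw [indicator_of_notMem (by simpa using ht.1.ne'), zero_add]
  refine Finset.sum_congr rfl fun n _ => ?_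
  have hlt := D.time_strictMono n.castSucc_lt_succ
  simp only [g]
  by_cases h1 : D.time n.castSucc < t <;> by_cases h2 : D.time n.succ < t
  · simp [indicator, h1, h2, not_le.2 h2]
  · simp [indicator, h1, h2, not_lt.1 h2]
  · exact absurd (hlt.trans h2) h1
  · simp [indicator, h1, h2]

theorem slicePairing_stRecon (D : GradientDiscretisation.{u} Ω T p)
    (hΩ : volume (Ω : Set (Space d)) < ∞) (v : Fin (D.N + 1) → D.I → ℝ) (w : D.I → ℝ)
    {t : ℝ} (ht : t ∈ Ioo 0 T) :
    slicePairing (volume.restrict (Ω : Set (Space d))) (D.stRecon v) (D.recon w) t =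
      (∫ x in (Ω : Set (Space d)), D.recon (v 0) x * D.recon w x) +
        ∑ n : Fin D.N, (∫ x in (Ω : Set (Space d)),
          D.recon (v n.succ - v n.castSucc) x * D.recon w x) *
          (Ioi (D.time n.castSucc)).indicator (fun _ => (1 : ℝ)) t := by
  have hi : ∀ u, Integrable (fun x => D.recon u x * D.recon w x)
      (volume.restrict (Ω : Set (Space d))) := fun u =>
    integrable_mul_of_memLp_two (D.memLp_recon hΩ u 2) (D.memLp_recon hΩ w 2)
  simp_rw [← integral_mul_const]
  rw [← integral_finsetSum _ fun n _ => (hi _).mul_const _,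
    ← integral_add (hi _) (integrable_finsetSum _ fun n _ => (hi _).mul_const _)]
  refine integral_congr_ae (.of_forall fun x => ?_)
  have e : D.stRecon v (x, t) = D.reconAt x (v 0) + ∑ n : Fin D.N,
      (Ioi (D.time n.castSucc)).indicator (fun _ => (1 : ℝ)) t *
        D.reconAt x (v n.succ - v n.castSucc) := by
    change D.reconAt x (D.atTime v t) = _
    rw [D.atTime_eq v ht, map_add, map_sum]
    simp only [map_smul, smul_eq_mul]
  simp only
  rw [e, add_mul, Finset.sum_mul]
  congr 1
  refine Finset.sum_congr rfl fun n _ => ?_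
  change _ = D.reconAt x _ * _ * _
  ring

theorem eLpNorm_translate_sub_le (D : GradientDiscretisation.{u} Ω T p) (hp : p ≠ 0)
    {ξ : Space d} {ε : ℝ≥0∞} (h : D.translationModulus ξ ≤ ε) (v : D.I → ℝ) :
    eLpNorm (fun x => D.recon v (x + ξ) - D.recon v x) p volume ≤ ε * D.gradNorm v := by
  by_cases hv : v = 0
  · subst hv
    have : ∀ x, D.recon (0 : D.I → ℝ) x = 0 := fun x => (D.reconAt x).map_zero
    simp [this]
  · rw [← ENNReal.div_le_iff (mt (D.gradNorm_eq_zero_iff hp v).1 hv) (D.gradNorm_ne_top v)]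
    exact (le_iSup₂_of_le (f := fun (v : D.I → ℝ) (_ : v ≠ 0) =>
      eLpNorm (fun x => D.recon v (x + ξ) - D.recon v x) p volume / D.gradNorm v)
      v hv le_rfl).trans h

end GradientDiscretisation

/-! ### Test functions -/

section TestFunctions

variable {d : ℕ} {Ω : TopologicalSpace.Opens (Space d)}

theorem continuous_gradient_testFunction (f : 𝓓(Ω, ℝ)) :
    Continuous (gradient (f : Space d → ℝ)) :=
  (InnerProductSpace.toDual ℝ (Space d)).symm.continuous.comp
    (f.contDiff.continuous_fderiv (by simp))

theorem hasCompactSupport_gradient_testFunction (f : 𝓓(Ω, ℝ)) :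
    HasCompactSupport (gradient (f : Space d → ℝ)) :=
  (f.hasCompactSupport.fderiv ℝ).comp_left
    (g := (InnerProductSpace.toDual ℝ (Space d)).symm) (map_zero _)

theorem testFunction_eq_zero (f : 𝓓(Ω, ℝ)) {x : Space d} (hx : x ∉ (Ω : Set (Space d))) :
    f x = 0 :=
  image_eq_zero_of_notMem_tsupport fun h => hx (f.tsupport_subset h)

theorem memLp_testFunction (f : 𝓓(Ω, ℝ)) (q : ℝ≥0∞) :
    MemLp (f : Space d → ℝ) q (volume.restrict (Ω : Set (Space d))) :=
  (f.continuous.memLp_of_hasCompactSupport f.hasCompactSupport).restrict _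

theorem memLp_gradient_testFunction (f : 𝓓(Ω, ℝ)) (q : ℝ≥0∞) :
    MemLp (gradient (f : Space d → ℝ)) q (volume.restrict (Ω : Set (Space d))) :=
  ((continuous_gradient_testFunction f).memLp_of_hasCompactSupport
    (hasCompactSupport_gradient_testFunction f)).restrict _

/-- Classical integration by parts on the whole space, tested against each fixed direction `v`. -/
theorem hasWeakGradient_testFunction (f : 𝓓(Ω, ℝ)) :
    HasWeakGradient Ω f (gradient (f : Space d → ℝ)) := by
  intro η
  have hi : ∀ f g : 𝓓(Ω, ℝ), Integrable (fun x => f x • gradient (g : Space d → ℝ) x) :=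
    fun f g => (f.continuous.smul (continuous_gradient_testFunction g)).integrable_of_hasCompactSupport
      f.hasCompactSupport.smul_right
  rw [setIntegral_eq_integral_of_forall_compl_eq_zero fun x hx => by
      rw [testFunction_eq_zero f hx, zero_smul],
    setIntegral_eq_integral_of_forall_compl_eq_zero fun x hx => by
      rw [testFunction_eq_zero η hx, zero_smul]]
  refine ext_inner_left ℝ fun v => ?_
  rw [inner_neg_right, ← integral_inner (hi _ _), ← integral_inner (hi _ _)]
  have hdf : ∀ f : 𝓓(Ω, ℝ), Differentiable ℝ (f : Space d → ℝ) := fun f =>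
    f.contDiff.differentiable (by simp)
  have hc : ∀ f : 𝓓(Ω, ℝ), Continuous fun x => fderiv ℝ (f : Space d → ℝ) x v := fun f =>
    (f.contDiff.continuous_fderiv (by simp)).clm_apply continuous_const
  have key := integral_mul_fderiv_eq_neg_fderiv_mul_of_integrable (μ := volume)
    (f := (f : Space d → ℝ)) (g := (η : Space d → ℝ)) (v := v)
    (((hc f).mul η.continuous).integrable_of_hasCompactSupport η.hasCompactSupport.mul_left)
    ((f.continuous.mul (hc η)).integrable_of_hasCompactSupport f.hasCompactSupport.mul_right)
    ((f.continuous.mul η.continuous).integrable_of_hasCompactSupport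
      f.hasCompactSupport.mul_right) (fun x _ => (hdf f) x) (fun x _ => (hdf η) x)
  have hg : ∀ (f : 𝓓(Ω, ℝ)) x, inner ℝ v (gradient (f : Space d → ℝ) x) =
      fderiv ℝ (f : Space d → ℝ) x v := by
    intro f x
    rw [real_inner_comm, gradient, InnerProductSpace.toDual_symm_apply]
  simp_rw [inner_smul_right, hg]
  rw [key]
  simp_rw [mul_comm]

theorem memW10p_testFunction (f : 𝓓(Ω, ℝ)) (p : ℝ≥0∞) :
    MemW10p Ω p f (gradient (f : Space d → ℝ)) where
  memLp := memLp_testFunction f p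
  memLp_grad := memLp_gradient_testFunction f p
  hasWeakGradient := hasWeakGradient_testFunction f
  approx ε hε := ⟨f, by simpa using hε⟩

/-- In the Hilbert space `L²(Ω)` it suffices that nothing but zero is orthogonal to all test
functions, which is the fundamental lemma of the calculus of variations. -/
theorem exists_testFunction_eLpNorm_sub_lt {η : Space d → ℝ}
    (hη : MemLp η 2 (volume.restrict (Ω : Set (Space d)))) {ε : ℝ≥0∞} (hε : 0 < ε) :
    ∃ g : 𝓓(Ω, ℝ),
      eLpNorm (fun x => η x - g x) 2 (volume.restrict (Ω : Set (Space d))) < ε := by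
  set ν := volume.restrict (Ω : Set (Space d)) with hν
  let K : Submodule ℝ (Lp ℝ 2 ν) :=
    { carrier := {f | ∃ g : 𝓓(Ω, ℝ), f =ᵐ[ν] g}
      add_mem' := by
        rintro a b ⟨g, hg⟩ ⟨g', hg'⟩
        refine ⟨g + g', (Lp.coeFn_add a b).trans ?_⟩
        filter_upwards [hg, hg'] with x h1 h2
        simp [h1, h2]
      zero_mem' := ⟨0, (Lp.coeFn_zero _ _ _).trans (.of_forall fun x => by simp)⟩
      smul_mem' := by
        rintro c a ⟨g, hg⟩
        refine ⟨c • g, (Lp.coeFn_smul c a).trans ?_⟩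
        filter_upwards [hg] with x h1
        simp [h1] }
  have hK : K.topologicalClosure = ⊤ := by
    rw [Submodule.topologicalClosure_eq_top_iff, Submodule.eq_bot_iff]
    intro f hf
    rw [Submodule.mem_orthogonal] at hf
    have hloc : LocallyIntegrableOn f (Ω : Set (Space d)) volume :=
      locallyIntegrableOn_of_locallyIntegrable_restrict
        ((Lp.memLp f).locallyIntegrable (by norm_num))
    have h0 := Ω.isOpen.ae_eq_zero_of_integral_contDiff_smul_eq_zero hloc fun g hg hgc hgs => by
      let G : 𝓓(Ω, ℝ) := ⟨g, by simpa using hg, hgc, hgs⟩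
      have hG : MemLp g 2 ν := memLp_testFunction G 2
      have := hf (hG.toLp g) ⟨G, hG.coeFn_toLp⟩
      rw [L2.inner_def] at this
      rw [← this, ← setIntegral_eq_integral_of_forall_compl_eq_zero (s := (Ω : Set (Space d)))
        fun x hx => by rw [show g x = 0 from testFunction_eq_zero G hx, zero_smul]]
      refine integral_congr_ae ?_
      filter_upwards [hG.coeFn_toLp] with x hx
      simp [hx, mul_comm]
    rw [Lp.eq_zero_iff_ae_eq_zero]
    exact (ae_restrict_iff' Ω.isOpen.measurableSet).2 h0
  have hmem : hη.toLp η ∈ closure (K : Set (Lp ℝ 2 ν)) := by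
    rw [← Submodule.topologicalClosure_coe, hK]
    trivial
  obtain ⟨f, ⟨g, hg⟩, hfd⟩ := EMetric.mem_closure_iff.1 hmem ε hε
  refine ⟨g, ?_⟩
  rw [Lp.edist_def] at hfd
  refine lt_of_eq_of_lt (eLpNorm_congr_ae ?_) hfd
  filter_upwards [hg, hη.coeFn_toLp] with x h1 h2
  simp [h1, h2]

end TestFunctions

/-! ### Strong convergence in time of the moments of the reconstructions -/

theorem tendsto_integral_sub_mul {α : Type*} [MeasurableSpace α] {μ : Measure α}
    {u : ℕ → α → ℝ} {w ψ : α → ℝ} (hu : ∀ m, MemLp (u m) 2 μ) (hw : MemLp w 2 μ)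
    (hψ : MemLp ψ 2 μ)
    (h : Tendsto (fun m => ∫ z, u m z * ψ z ∂μ) atTop (𝓝 (∫ z, w z * ψ z ∂μ))) :
    Tendsto (fun m => ∫ z, (u m z - w z) * ψ z ∂μ) atTop (𝓝 0) := by
  have e : ∀ m, ∫ z, (u m z - w z) * ψ z ∂μ = (∫ z, u m z * ψ z ∂μ) - ∫ z, w z * ψ z ∂μ := by
    intro m
    simp_rw [sub_mul]
    exact integral_sub (integrable_mul_of_memLp_two (hu m) hψ) (integrable_mul_of_memLp_two hw hψ)
  simp_rw [e]
  simpa using h.sub_const (∫ z, w z * ψ z ∂μ)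

theorem tendsto_eLpNorm_two_of_integral_sq {α : Type*} [MeasurableSpace α] {μ : Measure α}
    {q : ℕ → α → ℝ} (hq : ∀ m, MemLp (q m) 2 μ)
    (h : Tendsto (fun m => ∫ z, q m z * q m z ∂μ) atTop (𝓝 0)) :
    Tendsto (fun m => eLpNorm (q m) 2 μ) atTop (𝓝 0) := by
  have h1 : Tendsto (fun m => eLpNorm (q m) 2 μ ^ 2) atTop (𝓝 0) := by
    have e : ∀ m, eLpNorm (q m) 2 μ ^ 2 = ENNReal.ofReal (∫ z, q m z * q m z ∂μ) := by
      intro m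
      rw [eLpNorm_two_sq, ofReal_integral_eq_lintegral_ofReal
        (integrable_mul_of_memLp_two (hq m) (hq m)) (.of_forall fun z => mul_self_nonneg _)]
      refine lintegral_congr fun z => ?_
      rw [← ofReal_norm, ← ENNReal.ofReal_pow (norm_nonneg _), Real.norm_eq_abs, sq_abs, sq]
    simp_rw [e]
    simpa using ENNReal.tendsto_ofReal h
  have h2 := h1.ennrpow_const (1 / 2)
  refine (h2.congr fun m => ?_).trans (by simp)
  rw [← ENNReal.rpow_two, ← ENNReal.rpow_mul]
  norm_num

namespace GradientDiscretisation

variable {d : ℕ} {Ω : TopologicalSpace.Opens (Space d)} {T : ℝ} {p : ℝ≥0∞}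

/-- The `w m` nearly minimise the consistency defect of `η`. Their discrete gradients stay within
distance 1 of `∇η`, hence are bounded. -/
theorem exists_recon_approx (hΩ : volume (Ω : Set (Space d)) < ∞) (hp : 2 ≤ p)
    {D : ℕ → GradientDiscretisation.{u} Ω T p} (hcons : IsConsistent D) (η : 𝓓(Ω, ℝ)) :
    ∃ (w : (m : ℕ) → (D m).I → ℝ) (W : ℝ≥0), (∀ m, (D m).gradNorm (w m) ≤ W) ∧
      Tendsto (fun m => eLpNorm (fun x => η x - (D m).recon (w m) x) 2
        (volume.restrict (Ω : Set (Space d)))) atTop (𝓝 0) := by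
  set ν := volume.restrict (Ω : Set (Space d)) with hν
  have : IsFiniteMeasure ν := ⟨by simpa [hν] using hΩ⟩
  set G := gradient (η : Space d → ℝ)
  have hG : MemLp G p ν := memLp_gradient_testFunction η p
  have hdef := hcons.tendsto_defect η G (memLp_testFunction η 2) (memW10p_testFunction η p)
  -- The positive term `1/(m+1)` makes the inequality strict, so that a near-minimiser exists
  -- without attainment of the infimum.
  set s : ℕ → ℝ≥0∞ := fun m => (D m).consistencyDefect η G + (m + 1 : ℝ≥0∞)⁻¹ with hs
  have hs0 : Tendsto s atTop (𝓝 0) := by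
    have : Tendsto (fun m : ℕ => ((m : ℝ≥0∞) + 1)⁻¹) atTop (𝓝 0) := by
      have := (tendsto_add_atTop_iff_nat 1).2 ENNReal.tendsto_inv_nat_nhds_zero
      simpa using this
    simpa using hdef.add this
  have hex : ∀ m, ∃ w : (D m).I → ℝ, (D m).gradNorm w ≤ 1 + eLpNorm G p ν ∧
      (s m ≤ 1 → eLpNorm (fun x => (D m).recon w x - η x) (max p 2) ν ≤ s m) := by
    intro m
    by_cases h1 : s m ≤ 1
    · have hfin : (D m).consistencyDefect η G ≠ ∞ :=
        ((le_self_add.trans h1).trans_lt ENNReal.one_lt_top).ne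
      have hlt : (D m).consistencyDefect η G < s m :=
        ENNReal.lt_add_right hfin (by simp)
      obtain ⟨w, hw⟩ := iInf_lt_iff.1 hlt
      refine ⟨w, ?_, fun _ => le_self_add.trans hw.le⟩
      have h2 : eLpNorm (fun x => (D m).grad w x - G x) p ν ≤ 1 :=
        (le_add_self.trans hw.le).trans h1
      have h3 : (D m).gradNorm w ≤ eLpNorm (fun x => (D m).grad w x - G x) p ν +
          eLpNorm G p ν := by
        have := eLpNorm_add_le (μ := ν) (p := p) ((Lp.memLp ((D m).grad w)).1.sub hG.1) hG.1
          (le_trans (by norm_num) hp)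
        rw [sub_add_cancel] at this
        exact this
      exact h3.trans (add_le_add_left h2 _)
    -- This case concerns finitely many `m` only, so any element of bounded gradient norm serves.
    · exact ⟨0, by simp [gradNorm_zero], fun h => absurd h h1⟩
  choose w hw1 hw2 using hex
  have hW : (1 : ℝ≥0∞) + eLpNorm G p ν ≠ ∞ := ENNReal.add_ne_top.2 ⟨by simp, hG.2.ne⟩
  refine ⟨w, (1 + eLpNorm G p ν).toNNReal, fun m => ?_, ?_⟩
  · rw [ENNReal.coe_toNNReal hW]
    exact hw1 m
  · set c := ν univ ^ (1 / (2 : ℝ≥0∞).toReal - 1 / (max p 2).toReal) with hc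
    have hcfin : c ≠ ∞ := by
      refine ENNReal.rpow_ne_top_of_nonneg ?_ (measure_ne_top _ _)
      rw [max_eq_left hp, sub_nonneg]
      by_cases hpt : p = ∞
      · simp [hpt]
      · gcongr
        norm_num
    have hlim : Tendsto (fun m => s m * c) atTop (𝓝 0) := by
      simpa using ENNReal.Tendsto.mul_const hs0 (Or.inr hcfin)
    refine tendsto_of_tendsto_of_tendsto_of_le_of_le' tendsto_const_nhds hlim
      (.of_forall fun _ => zero_le) ?_
    filter_upwards [hs0.eventually_le_const (show (0 : ℝ≥0∞) < 1 by simp)] with m hm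
    have e : eLpNorm (fun x => η x - (D m).recon (w m) x) 2 ν =
        eLpNorm (fun x => (D m).recon (w m) x - η x) 2 ν := eLpNorm_sub_comm _ _ _ _
    rw [e]
    refine (eLpNorm_le_eLpNorm_mul_rpow_measure_univ (le_max_right p 2)
      (((D m).memLp_recon hΩ (w m) 2).1.sub (memLp_testFunction η 2).1)).trans ?_
    gcongr
    exact hw2 m hm

/-- Only a strongly null error separates the moment of `Π β_m` against `η` from its moment against
`Π w_m`, a step function of bounded variation. Pairing the weakly null `q m` with the latter gives
zero in the limit. -/
theorem tendsto_eLpNorm_slicePairing_testFunction (hΩ : volume (Ω : Set (Space d)) < ∞)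
    (hT : 0 < T) (hp : 2 ≤ p) {D : ℕ → GradientDiscretisation.{u} Ω T p} (hcons : IsConsistent D)
    {β : (m : ℕ) → Fin ((D m).N + 1) → (D m).I → ℝ} {C : ℝ≥0}
    (hC : ∀ m, (D m).derivDualNorm (β m) ≤ C) {ν : Measure (Space d)} {lam : Measure ℝ}
    (hν : ν = volume.restrict (Ω : Set (Space d))) (hlam : lam = volume.restrict (Ioo 0 T))
    {βlim : Space d × ℝ → ℝ} (hβ : ∀ m, MemLp ((D m).stRecon (β m)) 2 (ν.prod lam))
    (hlim : MemLp βlim 2 (ν.prod lam)) {M : ℝ≥0}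
    (hM : ∀ m, eLpNorm ((D m).stRecon (β m)) 2 (ν.prod lam) ≤ M)
    (hweak : ∀ ψ : Space d × ℝ → ℝ, MemLp ψ 2 (ν.prod lam) →
      Tendsto (fun m => ∫ z, (D m).stRecon (β m) z * ψ z ∂(ν.prod lam)) atTop
        (𝓝 (∫ z, βlim z * ψ z ∂(ν.prod lam)))) (η : 𝓓(Ω, ℝ)) :
    Tendsto (fun m => eLpNorm (slicePairing ν (fun z => (D m).stRecon (β m) z - βlim z) η) 2 lam)
      atTop (𝓝 0) := by
  have : IsFiniteMeasure ν := ⟨by simpa [hν] using hΩ⟩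
  have : IsFiniteMeasure lam := ⟨by simp [hlam]⟩
  have hη : MemLp (η : Space d → ℝ) 2 ν := hν ▸ memLp_testFunction η 2
  set h : ℕ → Space d × ℝ → ℝ := fun m z => (D m).stRecon (β m) z - βlim z with hh
  have hhm : ∀ m, MemLp (h m) 2 (ν.prod lam) := fun m => (hβ m).sub hlim
  set q : ℕ → ℝ → ℝ := fun m => slicePairing ν (h m) η with hq
  have hqm : ∀ m, MemLp (q m) 2 lam := fun m => memLp_slicePairing (hhm m) hη
  have hnull : ∀ θ : ℝ → ℝ, MemLp θ 2 lam →
      Tendsto (fun m => ∫ t, q m t * θ t ∂lam) atTop (𝓝 0) := by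
    intro θ hθ
    have h1 := tendsto_integral_sub_mul hβ hlim (memLp_tensor hη hθ)
      (hweak _ (memLp_tensor hη hθ))
    exact h1.congr fun m => integral_mul_tensor (hhm m) hη hθ
  obtain ⟨Q, hQ⟩ := exists_eLpNorm_le_of_weak (w := fun _ => 0) hqm fun θ hθ => by
    simpa using hnull θ hθ
  obtain ⟨w, W, hW, hw⟩ := exists_recon_approx hΩ hp hcons η
  rw [← hν] at hw
  have hwm : ∀ m, MemLp ((D m).recon (w m)) 2 ν := fun m => hν ▸ (D m).memLp_recon hΩ (w m) 2
  have hdm : ∀ m, MemLp (fun x => η x - (D m).recon (w m) x) 2 ν := fun m => hη.sub (hwm m)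
  set f : ℕ → ℝ → ℝ := fun m => slicePairing ν ((D m).stRecon (β m)) ((D m).recon (w m)) with hf
  have hfm : ∀ m, MemLp (f m) 2 lam := fun m => memLp_slicePairing (hβ m) (hwm m)
  set e : ℕ → ℝ → ℝ := fun m =>
    slicePairing ν ((D m).stRecon (β m)) (fun x => η x - (D m).recon (w m) x) with he
  have hem : ∀ m, MemLp (e m) 2 lam := fun m => memLp_slicePairing (hβ m) (hdm m)
  have hbm : MemLp (slicePairing ν βlim η) 2 lam := memLp_slicePairing hlim hη
  -- the part which is not in the discrete space
  have hel : Tendsto (fun m => eLpNorm (e m) 2 lam) atTop (𝓝 0) := by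
    have h1 : Tendsto (fun m => (M : ℝ≥0∞) *
        eLpNorm (fun x => η x - (D m).recon (w m) x) 2 ν) atTop (𝓝 0) := by
      simpa using ENNReal.Tendsto.const_mul hw (Or.inr ENNReal.coe_ne_top)
    refine tendsto_of_tendsto_of_tendsto_of_le_of_le tendsto_const_nhds h1
      (fun _ => zero_le) fun m => ?_
    exact (eLpNorm_slicePairing_le (hβ m).1 (hdm m).1).trans (mul_le_mul' (hM m) le_rfl)
  have hqe : Tendsto (fun m => ∫ t, q m t * e m t ∂lam) atTop (𝓝 0) := by
    rw [tendsto_zero_iff_enorm_tendsto_zero]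
    have h1 : Tendsto (fun m => (Q : ℝ≥0∞) * eLpNorm (e m) 2 lam) atTop (𝓝 0) := by
      simpa using ENNReal.Tendsto.const_mul hel (Or.inr ENNReal.coe_ne_top)
    refine tendsto_of_tendsto_of_tendsto_of_le_of_le tendsto_const_nhds h1
      (fun _ => zero_le) fun m => ?_
    exact (enorm_integral_mul_le (hqm m).1 (hem m).1).trans (mul_le_mul' (hQ m) le_rfl)
  have hfe : ∀ m, f m =ᵐ[lam] fun t => slicePairing ν ((D m).stRecon (β m)) η t - e m t := by
    intro m
    filter_upwards [slicePairing_sub_right_ae (hβ m) hη (hwm m)] with t ht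
    simp only [he, ht, hf]
    ring
  -- the discrete part is a step function of bounded variation
  obtain ⟨F, hF⟩ : ∃ F : ℝ≥0, ∀ m, eLpNorm (f m) 2 lam ≤ F := by
    -- The `L²` bound follows from weak convergence: `f m` is the weakly convergent moment against
    -- `η` minus the strongly null `e m`.
    refine exists_eLpNorm_le_of_weak (w := slicePairing ν βlim η) hfm fun θ hθ => ?_
    have h1 := hweak _ (memLp_tensor hη hθ)
    rw [integral_mul_tensor hlim hη hθ] at h1
    have h2 : Tendsto (fun m => ∫ t, e m t * θ t ∂lam) atTop (𝓝 0) := by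
      rw [tendsto_zero_iff_enorm_tendsto_zero]
      have h1 : Tendsto (fun m => eLpNorm (e m) 2 lam * eLpNorm θ 2 lam) atTop (𝓝 0) := by
        simpa using ENNReal.Tendsto.mul_const hel (Or.inr hθ.2.ne)
      exact tendsto_of_tendsto_of_tendsto_of_le_of_le tendsto_const_nhds h1
        (fun _ => zero_le) fun m => enorm_integral_mul_le (hem m).1 hθ.1
    have h3 := h1.sub h2
    rw [sub_zero] at h3
    refine h3.congr fun m => ?_
    rw [integral_mul_tensor (hβ m) hη hθ, ← integral_sub (integrable_mul_of_memLp_two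
      (memLp_slicePairing (hβ m) hη) hθ) (integrable_mul_of_memLp_two (hem m) hθ)]
    refine integral_congr_ae ?_
    filter_upwards [hfe m] with t ht
    rw [ht, sub_mul]
  have hqf : Tendsto (fun m => ∫ t, q m t * f m t ∂lam) atTop (𝓝 0) := by
    subst hlam hν
    exact tendsto_integral_mul_step hT hqm hQ (fun s _ => hnull _ (memLp_Ioi_indicator s)) hfm hF
      (fun m n => (D m).time_mem_Icc _)
      (fun m => (D m).sum_abs_integral_jump_le (by positivity) (β m) (w m) (hC m) (hW m))
      (fun m t ht => (D m).slicePairing_stRecon hΩ (β m) (w m) ht)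
  -- With `b` the moment of `βlim` against `η`, almost everywhere `q = f + e - b`, so `∫ q² = ∫ q f
  -- + ∫ q e - ∫ q b` and each term tends to zero.
  refine tendsto_eLpNorm_two_of_integral_sq hqm ?_
  have hsum := (hqf.add hqe).sub (hnull _ hbm)
  rw [add_zero, sub_zero] at hsum
  refine hsum.congr fun m => ?_
  have i1 := integrable_mul_of_memLp_two (hqm m) (hfm m)
  have i2 := integrable_mul_of_memLp_two (hqm m) (hem m)
  have i3 : Integrable (fun t => q m t * f m t + q m t * e m t) lam := i1.add i2
  rw [← integral_add i1 i2, ← integral_sub i3 (integrable_mul_of_memLp_two (hqm m) hbm)]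
  refine integral_congr_ae ?_
  filter_upwards [hfe m, slicePairing_sub_left_ae (hβ m) hlim hη] with t h1 h2
  change q m t = _ at h2
  rw [h1, ← mul_add, ← mul_sub, sub_add_cancel, ← h2]

end GradientDiscretisation

/-- Density of test functions: the maps `η ↦ slicePairing ν (h m) η` are bounded from `L²(Ω)` to
`L²(0,T)` uniformly in `m`. -/
theorem tendsto_eLpNorm_slicePairing {d : ℕ} {Ω : TopologicalSpace.Opens (Space d)}
    {ν : Measure (Space d)} {lam : Measure ℝ} [SFinite lam]
    (hν : ν = volume.restrict (Ω : Set (Space d))) {h : ℕ → Space d × ℝ → ℝ}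
    (hh : ∀ m, MemLp (h m) 2 (ν.prod lam)) {M : ℝ≥0}
    (hM : ∀ m, eLpNorm (h m) 2 (ν.prod lam) ≤ M)
    (htest : ∀ g : 𝓓(Ω, ℝ),
      Tendsto (fun m => eLpNorm (slicePairing ν (h m) g) 2 lam) atTop (𝓝 0))
    {η : Space d → ℝ} (hη : MemLp η 2 ν) :
    Tendsto (fun m => eLpNorm (slicePairing ν (h m) η) 2 lam) atTop (𝓝 0) := by
  have : SFinite ν := by rw [hν]; infer_instance
  rw [ENNReal.tendsto_nhds_zero]
  intro ε hε
  by_cases hεt : ε = ∞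
  · simp [hεt]
  have hM1 : ((M : ℝ≥0∞) + 1) ≠ 0 := by simp
  have hM1t : ((M : ℝ≥0∞) + 1) ≠ ∞ := by simp
  obtain ⟨g, hg⟩ := exists_testFunction_eLpNorm_sub_lt (hν ▸ hη)
    (show 0 < ε / 2 / (M + 1) from ENNReal.div_pos (ENNReal.half_pos hε.ne').ne' hM1t)
  rw [← hν] at hg
  have hgm : MemLp (g : Space d → ℝ) 2 ν := hν ▸ memLp_testFunction g 2
  filter_upwards [(htest g).eventually_le_const (ENNReal.half_pos hε.ne')] with m hm
  have hdm : MemLp (fun x => η x - g x) 2 ν := hη.sub hgm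
  have e : slicePairing ν (h m) η =ᵐ[lam] slicePairing ν (h m) g +
      slicePairing ν (h m) (fun x => η x - g x) := by
    filter_upwards [slicePairing_sub_right_ae (hh m) hη hgm] with t ht
    simp [ht]
  rw [eLpNorm_congr_ae e]
  calc _ ≤ eLpNorm (slicePairing ν (h m) g) 2 lam +
        eLpNorm (slicePairing ν (h m) (fun x => η x - g x)) 2 lam :=
        eLpNorm_add_le (memLp_slicePairing (hh m) hgm).1 (memLp_slicePairing (hh m) hdm).1
          (by norm_num)
    _ ≤ ε / 2 + (M + 1) * (ε / 2 / (M + 1)) := by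
        gcongr
        refine (eLpNorm_slicePairing_le (hh m).1 hdm.1).trans ?_
        exact mul_le_mul' ((hM m).trans le_self_add) hg.le
    _ = ε := by rw [ENNReal.mul_div_cancel hM1 hM1t, ENNReal.add_halves]

/-! ### Averages in space converge strongly -/

section Averages

variable {d : ℕ}

/-- The integrals of `f(·,t)` over balls of radius `δ`. -/
def ballIntegral (ν : Measure (Space d)) (δ : ℝ) (f : Space d × ℝ → ℝ) (z : Space d × ℝ) : ℝ :=
  slicePairing ν f ((Metric.ball z.1 δ).indicator fun _ => (1 : ℝ)) z.2

theorem memLp_ball_indicator {ν : Measure (Space d)} [IsFiniteMeasure ν] (y : Space d) (δ : ℝ) :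
    MemLp ((Metric.ball y δ).indicator fun _ => (1 : ℝ)) 2 ν :=
  (memLp_const 1).indicator measurableSet_ball

theorem stronglyMeasurable_ballIntegral {ν : Measure (Space d)} [SFinite ν] (δ : ℝ)
    {f : Space d × ℝ → ℝ} (hf : StronglyMeasurable f) :
    StronglyMeasurable (ballIntegral ν δ f) := by
  refine StronglyMeasurable.integral_prod_right'
    (f := fun w : (Space d × ℝ) × Space d =>
      f (w.2, w.1.2) * (Metric.ball w.1.1 δ).indicator (fun _ => (1 : ℝ)) w.2) ?_
  exact (hf.comp_measurable (by fun_prop : Measurable fun w : (Space d × ℝ) × Space d =>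
    (w.2, w.1.2))).mul ((measurable_ball_indicator δ).comp
      (by fun_prop : Measurable fun w : (Space d × ℝ) × Space d =>
        (w.1.1, w.2))).stronglyMeasurable

/-- For each fixed centre `y` the ball integral is a moment of `h m`, null in `L²(0,T)`. Tonelli and
dominated convergence in `y` then apply; the dominating constant is `(M c)²`, where `c` is the `L²`
norm of `1`. -/
theorem tendsto_eLpNorm_ballIntegral {ν : Measure (Space d)} {lam : Measure ℝ}
    [IsFiniteMeasure ν] [IsFiniteMeasure lam] (δ : ℝ) {h : ℕ → Space d × ℝ → ℝ}
    (hs : ∀ m, StronglyMeasurable (h m)) {M : ℝ≥0}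
    (hM : ∀ m, eLpNorm (h m) 2 (ν.prod lam) ≤ M)
    (hlim : ∀ η : Space d → ℝ, MemLp η 2 ν →
      Tendsto (fun m => eLpNorm (slicePairing ν (h m) η) 2 lam) atTop (𝓝 0)) :
    Tendsto (fun m => eLpNorm (ballIntegral ν δ (h m)) 2 (ν.prod lam)) atTop (𝓝 0) := by
  have hmeas : ∀ m, StronglyMeasurable (ballIntegral ν δ (h m)) := fun m =>
    stronglyMeasurable_ballIntegral δ (hs m)
  have e : ∀ m, eLpNorm (ballIntegral ν δ (h m)) 2 (ν.prod lam) ^ 2 =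
      ∫⁻ y, eLpNorm (slicePairing ν (h m)
        ((Metric.ball y δ).indicator fun _ => (1 : ℝ))) 2 lam ^ 2 ∂ν := by
    intro m
    simp_rw [eLpNorm_two_sq]
    rw [lintegral_prod _ ((hmeas m).enorm.pow_const 2).aemeasurable]
    rfl
  set c := eLpNorm (fun _ : Space d => (1 : ℝ)) 2 ν with hc
  have hcfin : c ≠ ∞ := (memLp_const (1 : ℝ)).2.ne
  have hsq : Tendsto (fun m => eLpNorm (ballIntegral ν δ (h m)) 2 (ν.prod lam) ^ 2) atTop
      (𝓝 0) := by
    simp_rw [e]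
    have := tendsto_lintegral_of_dominated_convergence (μ := ν) (f := fun _ => 0)
      (F := fun m y => eLpNorm (slicePairing ν (h m)
        ((Metric.ball y δ).indicator fun _ => (1 : ℝ))) 2 lam ^ 2)
      (fun _ => ((M : ℝ≥0∞) * c) ^ 2) (fun m => ?_) (fun m => .of_forall fun y => ?_) ?_
      (.of_forall fun y => ?_)
    · simpa using this
    · simp_rw [eLpNorm_two_sq]
      exact ((hmeas m).enorm.pow_const 2).lintegral_prod_right'
    · simp only
      gcongr
      refine (eLpNorm_slicePairing_le (hs m).aestronglyMeasurable
        (memLp_ball_indicator y δ).1).trans (mul_le_mul' (hM m) ?_)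
      exact eLpNorm_mono fun x => (norm_ball_indicator_le _ _ _).trans (by simp)
    · rw [lintegral_const]
      exact ENNReal.mul_ne_top (ENNReal.pow_ne_top (ENNReal.mul_ne_top ENNReal.coe_ne_top hcfin))
        (measure_ne_top _ _)
    · simpa using ENNReal.Tendsto.pow (n := 2) (hlim _ (memLp_ball_indicator y δ))
  refine ((hsq.ennrpow_const (1 / 2)).congr fun m => ?_).trans (by simp)
  rw [← ENNReal.rpow_two, ← ENNReal.rpow_mul]
  norm_num

end Averages

/-! ### Compactness in space: exchanging a function with its averages -/

theorem lintegral_mul_le_of_sq_le {α : Type*} [MeasurableSpace α] {μ : Measure α}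
    {a b : α → ℝ≥0∞} (ha : AEMeasurable a μ) (hb : AEMeasurable b μ) {A B : ℝ≥0∞}
    (hA : ∫⁻ x, a x ^ 2 ∂μ ≤ A ^ 2) (hB : ∫⁻ x, b x ^ 2 ∂μ ≤ B ^ 2) :
    ∫⁻ x, a x * b x ∂μ ≤ A * B := by
  have h := ENNReal.lintegral_mul_le_Lp_mul_Lq μ Real.HolderConjugate.two_two ha hb
  have hroot : ∀ {x y : ℝ≥0∞}, x ≤ y ^ 2 → x ^ (1 / 2 : ℝ) ≤ y := by
    intro x y hxy
    calc x ^ (1 / 2 : ℝ) ≤ (y ^ 2) ^ (1 / 2 : ℝ) := by gcongr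
      _ = y := by
        rw [← ENNReal.rpow_two, ← ENNReal.rpow_mul]
        norm_num
  simp only [ENNReal.rpow_ofNat] at h
  exact h.trans (mul_le_mul' (hroot hA) (hroot hB))

theorem aemeasurable_eLpNorm_slice {α : Type*} [MeasurableSpace α] {ν : Measure α}
    {lam : Measure ℝ} [SFinite ν] [SFinite lam] {f : α × ℝ → ℝ}
    (hf : AEStronglyMeasurable f (ν.prod lam)) :
    AEMeasurable (fun t => eLpNorm (fun x => f (x, t)) 2 ν) lam := by
  have h : (fun t => eLpNorm (fun x => f (x, t)) 2 ν) =
      fun t => (∫⁻ x, ‖f (x, t)‖ₑ ^ 2 ∂ν) ^ (1 / 2 : ℝ) := by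
    ext t
    rw [← eLpNorm_two_sq, ← ENNReal.rpow_two, ← ENNReal.rpow_mul]
    norm_num
  rw [h]
  exact ((hf.enorm.pow_const 2).prod_swap.lintegral_prod_right').pow_const _

namespace GradientDiscretisation

variable {d : ℕ} {Ω : TopologicalSpace.Opens (Space d)} {T : ℝ} {p : ℝ≥0∞}

/-- `ν(Ω)^{1/2 - 1/p}`, the norm of the inclusion of `L^p(Ω)` into `L^2(Ω)`. -/
def inclusionConst (Ω : TopologicalSpace.Opens (Space d)) (p : ℝ≥0∞) : ℝ≥0∞ :=
  volume (Ω : Set (Space d)) ^ (1 / (2 : ℝ≥0∞).toReal - 1 / p.toReal)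

theorem inclusionConst_ne_top (hΩ : volume (Ω : Set (Space d)) < ∞) (hp : 2 ≤ p) :
    inclusionConst Ω p ≠ ∞ := by
  refine ENNReal.rpow_ne_top_of_nonneg ?_ hΩ.ne
  rw [sub_nonneg]
  by_cases hpt : p = ∞
  · simp [hpt]
  · gcongr
    norm_num

/-- Discrete product rule: the increment of `ψ Π v` splits into `ψ` times the increment of `Π v`,
controlled in `L^p` by the translation modulus, and the increment of `ψ` times `Π v`. -/
theorem eLpNorm_indicator_mul_recon_translate_le (D : GradientDiscretisation.{u} Ω T p)
    (hp : 2 ≤ p) {ξ : Space d} {ε M : ℝ≥0}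
    (htr : D.translationModulus (-ξ) ≤ ε) {ψ : Space d → ℝ}
    (hψM : ∀ x ∈ (Ω : Set (Space d)), |ψ x| ≤ M)
    (hψ : ∀ x ∈ (Ω : Set (Space d)), x - ξ ∈ (Ω : Set (Space d)) → |ψ (x - ξ) - ψ x| ≤ ε)
    (v : D.I → ℝ) :
    eLpNorm (fun x => (Ω : Set (Space d)).indicator (fun x => ψ x * D.recon v x) (x - ξ) -
        ψ x * D.recon v x) 2 (volume.restrict (Ω : Set (Space d))) ≤
      ε * (M * inclusionConst Ω p * D.gradNorm v +
        eLpNorm (D.recon v) 2 (volume.restrict (Ω : Set (Space d)))) := by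
  set ν := volume.restrict (Ω : Set (Space d)) with hν
  have hp0 : p ≠ 0 := (lt_of_lt_of_le (by norm_num) hp).ne'
  have hm : AEStronglyMeasurable (fun x => D.recon v (x - ξ) - D.recon v x) volume :=
    ((D.aestronglyMeasurable_recon v).comp_measurePreserving
      (measurePreserving_sub_right volume ξ)).sub (D.aestronglyMeasurable_recon v)
  have h1 : eLpNorm (fun x => D.recon v (x - ξ) - D.recon v x) 2 ν ≤
      ε * D.gradNorm v * inclusionConst Ω p := by
    refine (eLpNorm_le_eLpNorm_mul_rpow_measure_univ hp hm.restrict).trans ?_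
    rw [inclusionConst, Measure.restrict_apply_univ]
    gcongr
    refine (eLpNorm_mono_measure _ Measure.restrict_le_self).trans ?_
    simpa [sub_eq_add_neg] using D.eLpNorm_translate_sub_le hp0 htr v
  have h2 : eLpNorm (fun x => (Ω : Set (Space d)).indicator (fun x => ψ x * D.recon v x) (x - ξ) -
      ψ x * D.recon v x) 2 ν ≤
      eLpNorm (fun x => (M : ℝ) * |D.recon v (x - ξ) - D.recon v x| + (ε : ℝ) * |D.recon v x|)
        2 ν := by
    refine eLpNorm_mono_ae_real ((ae_restrict_iff' Ω.isOpen.measurableSet).2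
      (.of_forall fun x hx => ?_))
    rw [Real.norm_eq_abs]
    by_cases hxξ : x - ξ ∈ (Ω : Set (Space d))
    · rw [indicator_of_mem hxξ]
      have e : ψ (x - ξ) * D.recon v (x - ξ) - ψ x * D.recon v x =
          ψ (x - ξ) * (D.recon v (x - ξ) - D.recon v x) + (ψ (x - ξ) - ψ x) * D.recon v x := by
        ring
      rw [e]
      refine (abs_add_le _ _).trans ?_
      rw [abs_mul, abs_mul]
      gcongr
      · exact hψM _ hxξ
      · exact hψ x hx hxξ
    -- When `x - ξ` leaves `Ω`, `Π v` vanishes there, so `|ψ(x) Π v(x)|` is itself bounded by `M`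
    -- times the increment of `Π v`; no regularity of `ψ` across the boundary is needed.
    · rw [indicator_of_notMem hxξ, D.recon_eq_zero v hxξ, zero_sub, zero_sub, abs_neg, abs_neg,
        abs_mul]
      have := hψM x hx
      have h3 : 0 ≤ (ε : ℝ) * |D.recon v x| := by positivity
      have h4 : |ψ x| * |D.recon v x| ≤ M * |D.recon v x| := by gcongr
      linarith
  refine h2.trans ?_
  have hm' : AEStronglyMeasurable (fun x => |D.recon v (x - ξ) - D.recon v x|) ν := by
    simpa only [Real.norm_eq_abs] using hm.restrict.norm
  have hr : AEStronglyMeasurable (fun x => |D.recon v x|) ν := by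
    simpa only [Real.norm_eq_abs] using (D.aestronglyMeasurable_recon v).restrict.norm
  refine (eLpNorm_add_le (hm'.const_mul _) (hr.const_mul _) (by norm_num)).trans ?_
  have h5 : ∀ (c : ℝ≥0) (f : Space d → ℝ),
      eLpNorm (fun x => (c : ℝ) * |f x|) 2 ν = c * eLpNorm f 2 ν := by
    intro c f
    have := eLpNorm_const_smul (c : ℝ) (fun x => |f x|) 2 ν
    have h6 : eLpNorm (fun x => |f x|) 2 ν = eLpNorm f 2 ν := eLpNorm_norm f
    rw [h6] at this
    simpa [Pi.smul_def] using this
  rw [h5, h5, mul_add]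
  refine add_le_add ((mul_le_mul_right h1 _).trans_eq ?_) le_rfl
  ring

/-- The spatial estimate holds for almost every `t`. Integrating it and using Cauchy–Schwarz in time
pairs the `L²` norm of `h(·,t)` with the gradient norm and the `L²` norm of the discrete function.
-/
theorem enorm_integral_ballIntegral_sub_le (D : GradientDiscretisation.{u} Ω T p)
    (hΩ : volume (Ω : Set (Space d)) < ∞) (hp : 2 ≤ p) {ν : Measure (Space d)} {lam : Measure ℝ}
    (hν : ν = volume.restrict (Ω : Set (Space d))) (hlam : lam = volume.restrict (Ioo 0 T))
    {δ : ℝ} {h φ : Space d × ℝ → ℝ} (hh : MemLp h 2 (ν.prod lam))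
    (hH : MemLp (ballIntegral ν δ h) 2 (ν.prod lam))
    (v : Fin (D.N + 1) → D.I → ℝ) (hv : MemLp (D.stRecon v) 2 (ν.prod lam))
    (hF : MemLp (fun z => φ z * D.stRecon v z) 2 (ν.prod lam))
    {ε M : ℝ≥0}
    (htr : ∀ ξ ∈ Metric.ball (0 : Space d) δ, D.translationModulus ξ ≤ ε)
    (hφM : ∀ x ∈ (Ω : Set (Space d)), ∀ t ∈ Ioo 0 T, |φ (x, t)| ≤ M)
    (hφ : ∀ x ∈ (Ω : Set (Space d)), ∀ y ∈ (Ω : Set (Space d)), ∀ t ∈ Ioo 0 T, dist y x < δ →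
      |φ (y, t) - φ (x, t)| ≤ ε) :
    ‖(∫ z, (φ z * D.stRecon v z) * ballIntegral ν δ h z ∂(ν.prod lam)) -
        volume.real (Metric.ball (0 : Space d) δ) *
          ∫ z, h z * (φ z * D.stRecon v z) ∂(ν.prod lam)‖ₑ ≤
      volume (Metric.ball (0 : Space d) δ) * (eLpNorm h 2 (ν.prod lam) *
        (ε * (M * inclusionConst Ω p * D.gradL2Norm v +
          eLpNorm (D.stRecon v) 2 (ν.prod lam)))) := by
  have : IsFiniteMeasure ν := ⟨by simpa [hν] using hΩ⟩
  have : IsFiniteMeasure lam := ⟨by simp [hlam]⟩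
  set F : Space d × ℝ → ℝ := fun z => φ z * D.stRecon v z with hFdef
  set V := volume (Metric.ball (0 : Space d) δ) with hV
  set K : ℝ≥0∞ := M * inclusionConst Ω p with hK
  let a : ℝ → ℝ≥0∞ := fun t => eLpNorm (fun x => h (x, t)) 2 ν
  let g : ℝ → ℝ≥0∞ := fun t => D.gradNorm (D.atTime v t)
  let r : ℝ → ℝ≥0∞ := fun t => eLpNorm (fun x => D.stRecon v (x, t)) 2 ν
  have ha : AEMeasurable a lam := aemeasurable_eLpNorm_slice hh.1
  have hr : AEMeasurable r lam := aemeasurable_eLpNorm_slice hv.1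
  have hg : AEMeasurable g lam :=
    ((D.measurable_gradNorm (le_trans (by norm_num) hp)).comp (D.measurable_atTime v)).aemeasurable
  have i1 := integrable_mul_of_memLp_two hF hH
  have i2 := integrable_mul_of_memLp_two hh hF
  rw [integral_prod_symm _ i1, integral_prod_symm _ i2, ← integral_const_mul,
    ← integral_sub i1.integral_prod_right (i2.integral_prod_right.const_mul _)]
  have hslice : ∀ᵐ t ∂lam, ‖(∫ x, F (x, t) * ballIntegral ν δ h (x, t) ∂ν) -
      volume.real (Metric.ball (0 : Space d) δ) * ∫ x, h (x, t) * F (x, t) ∂ν‖ₑ ≤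
      V * (ε * (K * (a t * g t) + a t * r t)) := by
    have hmem : ∀ᵐ t ∂lam, t ∈ Ioo 0 T := by
      rw [hlam]
      exact ae_restrict_mem measurableSet_Ioo
    filter_upwards [memLp_slice hh, memLp_slice hF, hmem] with t h1 h2 ht
    subst hν
    have := enorm_integral_ball_average_sub_le Ω.isOpen.measurableSet hΩ h1 h2
      (fun ξ hξ => D.eLpNorm_indicator_mul_recon_translate_le hp
        (htr (-ξ) (by simpa using hξ)) (fun x hx => hφM x hx t ht)
        (fun x hx hxξ => hφ x hx _ hxξ t ht (by simpa [dist_eq_norm] using hξ)) (D.atTime v t))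
    refine this.trans_eq ?_
    change a t * (ε * (K * g t + r t)) * V = _
    ring
  calc _ ≤ ∫⁻ t, ‖(∫ x, F (x, t) * ballIntegral ν δ h (x, t) ∂ν) -
        volume.real (Metric.ball (0 : Space d) δ) * ∫ x, h (x, t) * F (x, t) ∂ν‖ₑ ∂lam :=
        enorm_integral_le_lintegral_enorm _
    _ ≤ ∫⁻ t, V * (ε * (K * (a t * g t) + a t * r t)) ∂lam := lintegral_mono_ae hslice
    _ = V * (ε * (K * ∫⁻ t, a t * g t ∂lam + ∫⁻ t, a t * r t ∂lam)) := by
        have m1 : AEMeasurable (fun t => a t * g t) lam := ha.mul hg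
        have m2 : AEMeasurable (fun t => K * (a t * g t) + a t * r t) lam :=
          (m1.const_mul K).add (ha.mul hr)
        rw [lintegral_const_mul'' _ (m2.const_mul _), lintegral_const_mul'' _ m2,
          lintegral_add_left' (m1.const_mul K), lintegral_const_mul'' _ m1]
    _ ≤ V * (ε * (K * (eLpNorm h 2 (ν.prod lam) * D.gradL2Norm v) +
          eLpNorm h 2 (ν.prod lam) * eLpNorm (D.stRecon v) 2 (ν.prod lam))) := by
        gcongr
        · refine lintegral_mul_le_of_sq_le ha hg (eLpNorm_prod_two_sq hh.1).ge ?_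
          rw [D.gradL2Norm_sq, hlam]
        · exact lintegral_mul_le_of_sq_le ha hr (eLpNorm_prod_two_sq hh.1).ge
            (eLpNorm_prod_two_sq hv.1).ge
    _ = _ := by ring

end GradientDiscretisation

theorem slicePairing_congr_left_ae {α τ : Type*} [MeasurableSpace α] [MeasurableSpace τ]
    {ν : Measure α} {lam : Measure τ} [SFinite ν] [SFinite lam] {f g : α × τ → ℝ}
    (h : f =ᵐ[ν.prod lam] g) (η : α → ℝ) :
    slicePairing ν f η =ᵐ[lam] slicePairing ν g η := by
  have h1 : ∀ᵐ z ∂(lam.prod ν), f z.swap = g z.swap :=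
    Measure.measurePreserving_swap.quasiMeasurePreserving.ae h
  filter_upwards [Measure.ae_ae_of_ae_prod h1] with t ht
  refine integral_congr_ae ?_
  filter_upwards [ht] with x hx
  simp only [Prod.swap_prod_mk] at hx
  simp only [hx]

theorem exists_nnreal_pos_mul_le (R : ℝ≥0) {ε : ℝ≥0∞} (hε : 0 < ε) :
    ∃ r : ℝ≥0, 0 < r ∧ (R : ℝ≥0∞) * r ≤ ε := by
  obtain ⟨e, he0, he⟩ := ENNReal.lt_iff_exists_nnreal_btwn.1 hε
  have he0' : 0 < e := by exact_mod_cast he0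
  refine ⟨e / (R + 1), by positivity, le_trans ?_ he.le⟩
  have h : R * (e / (R + 1)) ≤ e := by
    calc R * (e / (R + 1)) ≤ (R + 1) * (e / (R + 1)) := by gcongr; simp
      _ = e := by field_simp
  exact_mod_cast h

namespace GradientDiscretisation

variable {d : ℕ} {Ω : TopologicalSpace.Opens (Space d)} {T : ℝ} {p : ℝ≥0∞}

/-- If `h_m` is bounded in `L²` and its moments in space tend to zero strongly in `L²(0,T)`, then
`h_m` tends to zero weakly against the reconstructions of a bounded sequence of discrete functions
multiplied by a uniformly continuous function. -/
theorem tendsto_integral_mul_stRecon (hΩ : volume (Ω : Set (Space d)) < ∞) (hp : 2 ≤ p)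
    {D : ℕ → GradientDiscretisation.{u} Ω T p} (hcomp : IsCompactSeq D)
    {ν : Measure (Space d)} {lam : Measure ℝ}
    (hν : ν = volume.restrict (Ω : Set (Space d))) (hlam : lam = volume.restrict (Ioo 0 T))
    {h : ℕ → Space d × ℝ → ℝ} {φ : Space d × ℝ → ℝ} (hs : ∀ m, StronglyMeasurable (h m))
    {Mh : ℝ≥0} (hMh : ∀ m, eLpNorm (h m) 2 (ν.prod lam) ≤ Mh)
    (hlim : ∀ η : Space d → ℝ, MemLp η 2 ν →
      Tendsto (fun m => eLpNorm (slicePairing ν (h m) η) 2 lam) atTop (𝓝 0))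
    {ζ : (m : ℕ) → Fin ((D m).N + 1) → (D m).I → ℝ}
    (hζ : ∀ m, MemLp ((D m).stRecon (ζ m)) 2 (ν.prod lam)) {Mζ : ℝ≥0}
    (hMζ : ∀ m, eLpNorm ((D m).stRecon (ζ m)) 2 (ν.prod lam) ≤ Mζ) {Cζ : ℝ≥0}
    (hCζ : ∀ m, (D m).gradL2Norm (ζ m) ≤ Cζ)
    (hφm : AEStronglyMeasurable φ (ν.prod lam)) {M : ℝ≥0}
    (hφM : ∀ x ∈ (Ω : Set (Space d)), ∀ t ∈ Ioo 0 T, |φ (x, t)| ≤ M)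
    (hφ : ∀ ε : ℝ≥0, 0 < ε → ∃ δ > 0, ∀ x ∈ (Ω : Set (Space d)), ∀ y ∈ (Ω : Set (Space d)),
      ∀ t ∈ Ioo 0 T, dist y x < δ → |φ (y, t) - φ (x, t)| ≤ ε) :
    Tendsto (fun m => ∫ z, h m z * (φ z * (D m).stRecon (ζ m) z) ∂(ν.prod lam)) atTop (𝓝 0) := by
  have : IsFiniteMeasure ν := ⟨by simpa [hν] using hΩ⟩
  have : IsFiniteMeasure lam := ⟨by simp [hlam]⟩
  have hhm : ∀ m, MemLp (h m) 2 (ν.prod lam) := fun m =>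
    ⟨(hs m).aestronglyMeasurable, (hMh m).trans_lt ENNReal.coe_lt_top⟩
  have hφae : ∀ᵐ z ∂(ν.prod lam), ‖φ z‖ ≤ M := by
    rw [hν, hlam, Measure.prod_restrict]
    exact (ae_restrict_iff' (Ω.isOpen.measurableSet.prod measurableSet_Ioo)).2
      (.of_forall fun z hz => hφM z.1 hz.1 z.2 hz.2)
  have hFle : ∀ m, ∀ᵐ z ∂(ν.prod lam),
      ‖φ z * (D m).stRecon (ζ m) z‖ ≤ M * ‖(D m).stRecon (ζ m) z‖ := by
    intro m
    filter_upwards [hφae] with z hz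
    rw [norm_mul]
    gcongr
  have hF : ∀ m, MemLp (fun z => φ z * (D m).stRecon (ζ m) z) 2 (ν.prod lam) := fun m =>
    (hζ m).of_le_mul (hφm.mul (hζ m).1) (hFle m)
  have hFM : ∀ m, eLpNorm (fun z => φ z * (D m).stRecon (ζ m) z) 2 (ν.prod lam) ≤ M * Mζ := by
    intro m
    refine (eLpNorm_le_mul_eLpNorm_of_ae_le_mul (hFle m) 2).trans ?_
    rw [ENNReal.ofReal_coe_nnreal]
    gcongr
    exact hMζ m
  obtain ⟨c, hc⟩ : ∃ c : ℝ≥0, inclusionConst Ω p = c :=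
    ⟨_, (ENNReal.coe_toNNReal (inclusionConst_ne_top hΩ hp)).symm⟩
  rw [tendsto_zero_iff_enorm_tendsto_zero, ENNReal.tendsto_nhds_zero]
  intro ε hε
  -- `r` bounds both the translation modulus and the oscillation of `φ` at scale `δ`; it is chosen
  -- so that the averaging error, relative to the volume of the ball, is at most `ε / 2` for every
  -- `m`.
  obtain ⟨r, hr0, hr⟩ := exists_nnreal_pos_mul_le (Mh * (M * c * Cζ + Mζ))
    (ENNReal.half_pos hε.ne')
  obtain ⟨δ₁, hδ₁, hφδ⟩ := hφ r hr0
  obtain ⟨δ₂, hδ₂, htr⟩ := Metric.eventually_nhds_iff_ball.1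
    ((ENNReal.tendsto_nhds_zero.1 hcomp) r (by exact_mod_cast hr0))
  set δ := min δ₁ δ₂ with hδ
  have hδ0 : 0 < δ := lt_min hδ₁ hδ₂
  set V := volume (Metric.ball (0 : Space d) δ) with hV
  have hVt : V ≠ ∞ := measure_ball_lt_top.ne
  have hV0 : V ≠ 0 := (Metric.measure_ball_pos volume _ hδ0).ne'
  have hH := tendsto_eLpNorm_ballIntegral (ν := ν) (lam := lam) δ hs hMh hlim
  have hsmall : Tendsto (fun m => ((M : ℝ≥0∞) * Mζ) *
      eLpNorm (ballIntegral ν δ (h m)) 2 (ν.prod lam)) atTop (𝓝 0) := by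
    simpa using ENNReal.Tendsto.const_mul hH (Or.inr (by finiteness))
  -- With `δ` now fixed, `m` is taken large. Smallness is measured relative to the volume `V`, which
  -- is cancelled at the end.
  filter_upwards [hsmall.eventually_le_const (show 0 < V * (ε / 2) from
    ENNReal.mul_pos hV0 (ENNReal.half_pos hε.ne').ne'),
    hH.eventually_lt_const zero_lt_one] with m hm hm1
  have hHm : MemLp (ballIntegral ν δ (h m)) 2 (ν.prod lam) :=
    ⟨(stronglyMeasurable_ballIntegral δ (hs m)).aestronglyMeasurable,
      hm1.trans ENNReal.one_lt_top⟩
  have key := (D m).enorm_integral_ballIntegral_sub_le hΩ hp hν hlam (hhm m) hHm (ζ m) (hζ m)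
    (hF m) (fun ξ hξ => (le_iSup (fun m => (D m).translationModulus ξ) m).trans
      (htr ξ (Metric.ball_subset_ball (min_le_right _ _) hξ))) hφM
    (fun x hx y hy t ht hxy => hφδ x hx y hy t ht (hxy.trans_le (min_le_left _ _)))
  set A := ∫ z, (φ z * (D m).stRecon (ζ m) z) * ballIntegral ν δ (h m) z ∂(ν.prod lam)
  set I := ∫ z, h m z * (φ z * (D m).stRecon (ζ m) z) ∂(ν.prod lam)
  have hA : ‖A‖ₑ ≤ V * (ε / 2) :=
    (enorm_integral_mul_le (hF m).1 hHm.1).trans ((mul_le_mul' (hFM m) le_rfl).trans hm)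
  have hB : eLpNorm (h m) 2 (ν.prod lam) * (r * (M * inclusionConst Ω p * (D m).gradL2Norm (ζ m) +
      eLpNorm ((D m).stRecon (ζ m)) 2 (ν.prod lam))) ≤ ε / 2 := by
    calc _ ≤ (Mh : ℝ≥0∞) * (r * (M * c * Cζ + Mζ)) := by
          rw [hc]
          gcongr
          · exact hMh m
          · exact hCζ m
          · exact hMζ m
      _ = ((Mh * (M * c * Cζ + Mζ) : ℝ≥0) : ℝ≥0∞) * r := by
          push_cast
          ring
      _ ≤ ε / 2 := hr
  have hVI : V * ‖I‖ₑ = ‖volume.real (Metric.ball (0 : Space d) δ) * I‖ₑ := by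
    rw [enorm_mul, Real.enorm_eq_ofReal measureReal_nonneg, Measure.real, ENNReal.ofReal_toReal hVt]
  have hfin : V * ‖I‖ₑ ≤ V * ε := by
    rw [hVI]
    calc _ = ‖A - (A - volume.real (Metric.ball (0 : Space d) δ) * I)‖ₑ := by
          rw [sub_sub_cancel]
      _ ≤ ‖A‖ₑ + ‖A - volume.real (Metric.ball (0 : Space d) δ) * I‖ₑ := enorm_sub_le
      _ ≤ V * (ε / 2) + V * (ε / 2) := add_le_add hA (key.trans (mul_le_mul_right hB _))
      _ = V * ε := by rw [← mul_add, ENNReal.add_halves]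
  exact (ENNReal.mul_le_mul_iff_right hV0 hVt).1 hfin

end GradientDiscretisation

end

/-! ### Conclusion: splitting off the weak limit of the first factor -/

theorem theorem5p3 {d : ℕ} (hd : 0 < d) (Ω : TopologicalSpace.Opens (Space d))
    (hΩ : Bornology.IsBounded (Ω : Set (Space d))) {T : ℝ} (hT : 0 < T)
    {p : ℝ≥0∞} (hp : 2 ≤ p) (hp_top : p ≠ ∞)
    (D : ℕ → GradientDiscretisation.{u} Ω T p)
    (hcons : GradientDiscretisation.IsConsistent D)
    (hcomp : GradientDiscretisation.IsCompactSeq D)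
    (β ζ : (m : ℕ) → Fin ((D m).N + 1) → (D m).I → ℝ)
    (hβ_deriv : ∃ C : ℝ≥0, ∀ m, (D m).derivDualNorm (β m) ≤ C)
    (hζ_grad : ∃ C : ℝ≥0, ∀ m, (D m).gradL2Norm (ζ m) ≤ C)
    (βlim ζlim : Space d × ℝ → ℝ)
    (hβ_weak : WeakL2Tendsto ((Ω : Set (Space d)) ×ˢ Ioo 0 T)
      (fun m => (D m).stRecon (β m)) βlim)
    (hζ_weak : WeakL2Tendsto ((Ω : Set (Space d)) ×ˢ Ioo 0 T)
      (fun m => (D m).stRecon (ζ m)) ζlim)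
    (φ : Space d × ℝ → ℝ)
    (hφ : ContinuousOn φ (closure (Ω : Set (Space d)) ×ˢ Icc 0 T)) :
    Tendsto
      (fun m => ∫ z in (Ω : Set (Space d)) ×ˢ Ioo 0 T,
        (D m).stRecon (β m) z * (D m).stRecon (ζ m) z * φ z)
      atTop (𝓝 (∫ z in (Ω : Set (Space d)) ×ˢ Ioo 0 T, βlim z * ζlim z * φ z)) := by
  have hΩv : volume (Ω : Set (Space d)) < ∞ := hΩ.measure_lt_top
  set ν := volume.restrict (Ω : Set (Space d)) with hν
  set lam := (volume : Measure ℝ).restrict (Ioo 0 T) with hlam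
  have : IsFiniteMeasure ν := ⟨by simpa [hν] using hΩv⟩
  have : IsFiniteMeasure lam := ⟨by simp [hlam]⟩
  have hprod : (volume : Measure (Space d × ℝ)).restrict ((Ω : Set (Space d)) ×ˢ Ioo 0 T) =
      ν.prod lam := by
    rw [hν, hlam, Measure.prod_restrict, ← Measure.volume_eq_prod]
  obtain ⟨hβ, hβl, hβw⟩ := hβ_weak
  obtain ⟨hζ, -, hζw⟩ := hζ_weak
  rw [hprod] at hβl ⊢
  simp only [hprod] at hβ hβw hζ hζw
  obtain ⟨Cβ, hCβ⟩ := hβ_deriv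
  obtain ⟨Cζ, hCζ⟩ := hζ_grad
  obtain ⟨Mβ, hMβ⟩ := exists_eLpNorm_le_of_weak hβ hβw
  obtain ⟨Mζ, hMζ⟩ := exists_eLpNorm_le_of_weak hζ hζw
  -- the test function
  have hK : IsCompact (closure (Ω : Set (Space d)) ×ˢ Icc 0 T) :=
    hΩ.isCompact_closure.prod isCompact_Icc
  have hsub : (Ω : Set (Space d)) ×ˢ Ioo 0 T ⊆ closure (Ω : Set (Space d)) ×ˢ Icc 0 T :=
    prod_mono subset_closure Ioo_subset_Icc_self
  obtain ⟨M, hM⟩ : ∃ M : ℝ≥0, ∀ x ∈ (Ω : Set (Space d)), ∀ t ∈ Ioo 0 T, |φ (x, t)| ≤ M := by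
    obtain ⟨C, hC⟩ := hK.exists_bound_of_continuousOn hφ
    exact ⟨C.toNNReal, fun x hx t ht => (hC (x, t) (hsub ⟨hx, ht⟩)).trans (Real.le_coe_toNNReal C)⟩
  have hφm : AEStronglyMeasurable φ (ν.prod lam) := by
    rw [← hprod]
    exact (hφ.mono hsub).aestronglyMeasurable (Ω.isOpen.measurableSet.prod measurableSet_Ioo)
  have hφu : ∀ ε : ℝ≥0, 0 < ε → ∃ δ > 0, ∀ x ∈ (Ω : Set (Space d)), ∀ y ∈ (Ω : Set (Space d)),
      ∀ t ∈ Ioo 0 T, dist y x < δ → |φ (y, t) - φ (x, t)| ≤ ε := by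
    intro ε hε
    obtain ⟨δ, hδ, h⟩ := Metric.uniformContinuousOn_iff.1
      (hK.uniformContinuousOn_of_continuous hφ) ε (by exact_mod_cast hε)
    refine ⟨δ, hδ, fun x hx y hy t ht hxy => ?_⟩
    rw [← Real.dist_eq]
    exact (h (y, t) (hsub ⟨hy, ht⟩) (x, t) (hsub ⟨hx, ht⟩) (by simpa [Prod.dist_eq] using hxy)).le
  have hφae : ∀ᵐ z ∂(ν.prod lam), ‖φ z‖ ≤ M := by
    rw [← hprod]
    exact (ae_restrict_iff' (Ω.isOpen.measurableSet.prod measurableSet_Ioo)).2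
      (.of_forall fun z hz => hM z.1 hz.1 z.2 hz.2)
  have hφmul : ∀ {f : Space d × ℝ → ℝ}, MemLp f 2 (ν.prod lam) →
      MemLp (fun z => φ z * f z) 2 (ν.prod lam) := by
    intro f hf
    refine hf.of_le_mul (c := M) (hφm.mul hf.1) ?_
    filter_upwards [hφae] with z hz
    rw [norm_mul]
    gcongr
  -- the error in the first factor
  have hh : ∀ m, MemLp (fun z => (D m).stRecon (β m) z - βlim z) 2 (ν.prod lam) := fun m =>
    (hβ m).sub hβl
  -- Strongly measurable representatives make the ball integrals jointly measurable in centre and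
  -- time.
  let h : ℕ → Space d × ℝ → ℝ := fun m => (hh m).1.mk _
  have hae : ∀ m, (fun z => (D m).stRecon (β m) z - βlim z) =ᵐ[ν.prod lam] h m := fun m =>
    (hh m).1.ae_eq_mk
  obtain ⟨B, hB⟩ : ∃ B : ℝ≥0, ∀ m,
      eLpNorm (fun z => (D m).stRecon (β m) z - βlim z) 2 (ν.prod lam) ≤ B :=
    exists_eLpNorm_le_of_weak (w := fun _ => 0) hh fun ψ hψ => by
      simpa using tendsto_integral_sub_mul hβ hβl hψ (hβw ψ hψ)
  have hmom : ∀ η : Space d → ℝ, MemLp η 2 ν →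
      Tendsto (fun m => eLpNorm (slicePairing ν (h m) η) 2 lam) atTop (𝓝 0) := by
    intro η hη
    refine (tendsto_eLpNorm_slicePairing hν hh hB (fun g =>
      GradientDiscretisation.tendsto_eLpNorm_slicePairing_testFunction hΩv hT hp hcons hCβ hν hlam
        hβ hβl hMβ hβw g)
      hη).congr fun m => ?_
    exact eLpNorm_congr_ae (slicePairing_congr_left_ae (hae m) η)
  have hmain := GradientDiscretisation.tendsto_integral_mul_stRecon hΩv hp hcomp hν hlam
    (fun m => (hh m).1.stronglyMeasurable_mk)
    (fun m => (eLpNorm_congr_ae (hae m)).symm.trans_le (hB m)) hmom hζ hMζ hCζ hφm hM hφu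
  -- The part containing `βlim` is linear in `ζ`: `φ βlim` is a fixed `L²` test function.
  have hlin := hζw _ (hφmul hβl)
  have hsum := hmain.add hlin
  rw [zero_add] at hsum
  have e : ∫ z, ζlim z * (φ z * βlim z) ∂(ν.prod lam) =
      ∫ z, βlim z * ζlim z * φ z ∂(ν.prod lam) := by
    congr 1 with z
    ring
  rw [e] at hsum
  refine hsum.congr fun m => ?_
  rw [← integral_add (integrable_mul_of_memLp_two ((memLp_congr_ae (hae m)).1 (hh m))
    (hφmul (hζ m))) (integrable_mul_of_memLp_two (hζ m) (hφmul hβl))]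
  refine integral_congr_ae ?_
  filter_upwards [hae m] with z hz
  change h m z * _ + _ = _
  rw [← hz]
  ring
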